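/- **Setting.** Fix partially ordered name spaces $A_P$ (places) and $A_T$ (transitions), each with a greatest element. A net $N=(P,T,pre,post,p_\ell,t_\ell,m)$ has $pre,post:T\to P^\oplus$, labels $p_\ell:P\to A_P$, $t_\ell:T\to A_T$ and a marking $m\in P^\oplus$. A net morphism is a pair of maps $(f_P,f_T)$ compatible with $pre$ and $post$ such that $m_1(p)\le m_2(f_P(p))$ and the label of an image is $\le$ the label of the original; it is strict if it is injective and preserves labels and marking exactly. Rules are spans $L\leftarrow K\to R$ of strict morphisms; a direct transformation of $N$ by a rule at an occurrence $o:L\to N$ is given by a double pushout in the category of nets. A reconfigurable net with substitutions consists of a net $N$, local name spaces, a set of local rules not involving names of substitution transitions, and a set $sT\subseteq T$ of substitution transitions, whose labels are pairwise distinct and form a name space of their own (no other transition of $N$ has a label in it). For every $t\in sT$ it has a substitution rule $subst(t)=(Net(t)\leftarrow CP(t)\to SN^t)$, where $Net(t)$ is $t$ with its adjacent places, $CP(t)$ consists of these places only (labels and marking being restricted from $N$), and $SN^t$ is again a reconfigurable net with substitutions (the nesting is well-founded). The names of connecting places belong to the place name space of $SN^t$. The local transition name spaces of different nets of the hierarchy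 have at most the greatest name in common, and this is not the label of a substitution transition. A hierarchical reconfigurable net $HN$ consists of such a net and a set of global rules. For a family of rules and a net $N$, let $S$ be the set of all $s=(r,o)$ with $r$ a rule of the family and $o$ an injective occurrence of $r$ in $N$. $N\Rightarrow^{\sum_{s\in S}s}F$ means that $F$ results from $N$ by the parallel rule $\coprod_s L_s\leftarrow\coprod_s K_s\to\coprod_s R_s$ at the induced occurrence $\coprod_s L_s\to N$. $N\Rightarrow^{sr!}\widehat F$ means that $\widehat F$ results from $N$ by a finite sequence of direct transformations by rules of the family at injective occurrences, and that no rule of the family is applicable to $\widehat F$ at an injective occurrence. **Theorem (Equivalence of transformation unit application and flattening process).** Let $HN$ be a hierarchical reconfigurable net with underlying net $N$. 1. Take as rules the substitution rules $subst(t)$, $t\in sT$, of $N$. If $HN\Rightarrow^{\sum_{s\in S}s}F$ and $HN\Rightarrow^{sr!}\widehat F$, then $F\cong\widehat F$. Moreover each $t\in sT$ occurs in exactly one substitution $s\in S$, and in every such sequence leading to $\widehat F$ each substitution rule is applied exactly once. 2. The same holds for the nested hierarchy: if $F$ results from $N$ by the recursive flattening (parallel transformation by all substitutions of $N$, then by those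 that come with the inserted subnets, and so on until no substitution transitions are left), and if $HN\Rightarrow^{sr!}\widehat F$ with the substitution rules of all nesting levels, then $F\cong\widehat F$, and in every such sequence the substitution rule of each substitution transition of the hierarchy is applied exactly once. 3. No substitution $s=(r,o)\in S$ of $N$ is parallel independent of itself, where $s_1,s_2$ are parallel independent if $o_1(L_1)\cap o_2(L_2)\subseteq o_1(l_1(K_1))\cap o_2(l_2(K_2))$ on places and on transitions. -/

import Mathlib

open CategoryTheory

universe u v w

/-- Marked labelled place/transition nets over the name spaces `AP` (places) and `AT`
(transitions). `P →₀ ℕ` is the free commutative monoid of finite linear sums over `P`. -/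
structure PTNet (AP : Type v) (AT : Type w) where
  /-- places -/
  P : Type u
  /-- transitions -/
  T : Type u
  pre : T → P →₀ ℕ
  post : T → P →₀ ℕ
  /-- place labels -/
  pl : P → AP
  /-- transition labels -/
  tl : T → AT
  /-- the marking -/
  mrk : P →₀ ℕ

namespace PTNet

variable {AP : Type v} {AT : Type w}

section Morphisms

variable [PartialOrder AP] [PartialOrder AT]

/-- Net morphisms: compatible with the arcs; tokens may be added and labels may become smaller. -/
@[ext]
structure Hom (N₁ N₂ : PTNet.{u} AP AT) : Type u where
  fP : N₁.P → N₂.P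
  fT : N₁.T → N₂.T
  map_pre : ∀ t, N₂.pre (fT t) = Finsupp.mapDomain fP (N₁.pre t)
  map_post : ∀ t, N₂.post (fT t) = Finsupp.mapDomain fP (N₁.post t)
  map_mrk : ∀ p, N₁.mrk p ≤ N₂.mrk (fP p)
  map_pl : ∀ p, N₂.pl (fP p) ≤ N₁.pl p
  map_tl : ∀ t, N₂.tl (fT t) ≤ N₁.tl t

instance : Category.{u} (PTNet.{u} AP AT) where
  Hom N₁ N₂ := Hom N₁ N₂
  id N :=
    { fP := id
      fT := id
      map_pre := fun t => by simp
      map_post := fun t => by simp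
      map_mrk := fun _ => le_rfl
      map_pl := fun _ => le_rfl
      map_tl := fun _ => le_rfl }
  comp f g :=
    { fP := g.fP ∘ f.fP
      fT := g.fT ∘ f.fT
      map_pre := fun t => by
        simp only [Function.comp_apply, g.map_pre, f.map_pre, Finsupp.mapDomain_comp]
      map_post := fun t => by
        simp only [Function.comp_apply, g.map_post, f.map_post, Finsupp.mapDomain_comp]
      map_mrk := fun p => (f.map_mrk p).trans (g.map_mrk _)
      map_pl := fun p => (g.map_pl _).trans (f.map_pl p)
      map_tl := fun t => (g.map_tl _).trans (f.map_tl t) }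

/-- Injective net morphisms. -/
def IsInj {N₁ N₂ : PTNet.{u} AP AT} (f : N₁ ⟶ N₂) : Prop :=
  Function.Injective (Hom.fP f) ∧ Function.Injective (Hom.fT f)

/-- Strict net morphisms: injective, preserving labels and marking exactly. -/
structure IsStrict {N₁ N₂ : PTNet.{u} AP AT} (f : N₁ ⟶ N₂) : Prop where
  inj : IsInj f
  pl_eq : ∀ p, N₂.pl (Hom.fP f p) = N₁.pl p
  tl_eq : ∀ t, N₂.tl (Hom.fT f t) = N₁.tl t
  mrk_eq : ∀ p, N₁.mrk p = N₂.mrk (Hom.fP f p)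

end Morphisms

/-- The places adjacent to a transition, `•t ∪ t•`. -/
def adj (N : PTNet.{u} AP AT) (t : N.T) : Set N.P :=
  {p | N.pre t p ≠ 0 ∨ N.post t p ≠ 0}

/-- `Net(t)`: the transition `t` with its adjacent places, everything restricted from `N`. -/
noncomputable def netOf (N : PTNet.{u} AP AT) (t : N.T) : PTNet.{u} AP AT where
  P := {p : N.P // p ∈ N.adj t}
  T := PUnit.{u + 1}
  pre := fun _ => (N.pre t).subtypeDomain (fun p => p ∈ N.adj t)
  post := fun _ => (N.post t).subtypeDomain (fun p => p ∈ N.adj t)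
  pl := fun p => N.pl p.1
  tl := fun _ => N.tl t
  mrk := N.mrk.subtypeDomain (fun p => p ∈ N.adj t)

/-- `CP(t)`: the connecting places of `t`, without any transition. -/
noncomputable def connOf (N : PTNet.{u} AP AT) (t : N.T) : PTNet.{u} AP AT where
  P := {p : N.P // p ∈ N.adj t}
  T := PEmpty.{u + 1}
  pre := PEmpty.elim
  post := PEmpty.elim
  pl := fun p => N.pl p.1
  tl := PEmpty.elim
  mrk := N.mrk.subtypeDomain (fun p => p ∈ N.adj t)

/-- All places and transitions of `N` have their labels in the given sets. -/
def Over (N : PTNet.{u} AP AT) (SP : Set AP) (ST : Set AT) : Prop :=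
  (∀ p, N.pl p ∈ SP) ∧ ∀ t, N.tl t ∈ ST

variable [PartialOrder AP] [PartialOrder AT]

/-- The inclusion `CP(t) ⟶ Net(t)`. -/
noncomputable def connIncl (N : PTNet.{u} AP AT) (t : N.T) : N.connOf t ⟶ N.netOf t :=
  ({ fP := id
     fT := PEmpty.elim
     map_pre := fun x => x.elim
     map_post := fun x => x.elim
     map_mrk := fun _ => le_rfl
     map_pl := fun _ => le_rfl
     map_tl := fun x => x.elim } : Hom (N.connOf t) (N.netOf t))

theorem connIncl_isStrict (N : PTNet.{u} AP AT) (t : N.T) : IsStrict (N.connIncl t) where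
  inj := ⟨fun _ _ h => h, fun x => x.elim⟩
  pl_eq := fun _ => rfl
  tl_eq := fun x => x.elim
  mrk_eq := fun _ => rfl

/-- A rule `L ⟵ K ⟶ R`, a span of strict net morphisms. -/
structure Rule (AP : Type v) (AT : Type w) [PartialOrder AP] [PartialOrder AT] where
  L : PTNet.{u} AP AT
  K : PTNet.{u} AP AT
  R : PTNet.{u} AP AT
  l : K ⟶ L
  r : K ⟶ R
  l_strict : IsStrict l
  r_strict : IsStrict r

/-- The three nets of a rule have their labels in the given sets. -/
def Rule.Over (ρ : Rule.{u} AP AT) (SP : Set AP) (ST : Set AT) : Prop :=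
  ρ.L.Over SP ST ∧ ρ.K.Over SP ST ∧ ρ.R.Over SP ST

/-- The span `L ⟵ K ⟶ R` transforms `N` at `o : L ⟶ N` into `M` by a double pushout. -/
def DPO {L K R N : PTNet.{u} AP AT} (l : K ⟶ L) (r : K ⟶ R) (o : L ⟶ N)
    (M : PTNet.{u} AP AT) : Prop :=
  ∃ (D : PTNet.{u} AP AT) (k : K ⟶ D) (g : D ⟶ N) (n : R ⟶ M) (h : D ⟶ M),
    IsPushout l k o g ∧ IsPushout r k n h

/-- The direct transformation of `N` into `M` by the rule `ρ` at the occurrence `o`. -/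
def Rule.Step (ρ : Rule.{u} AP AT) {N : PTNet.{u} AP AT} (o : ρ.L ⟶ N)
    (M : PTNet.{u} AP AT) : Prop :=
  DPO ρ.l ρ.r o M

section Families

variable {ι : Type u}

/-- `Derivation ρ N l M`: `M` results from `N` by applying the rules `ρ i`, `i` running
through the list `l` in this order, each at some injective occurrence. -/
inductive Derivation (ρ : ι → Rule.{u} AP AT) :
    PTNet.{u} AP AT → List ι → PTNet.{u} AP AT → Prop
  | nil (N : PTNet.{u} AP AT) : Derivation ρ N [] N
  | cons {N M F : PTNet.{u} AP AT} {l : List ι} (i : ι) (o : (ρ i).L ⟶ N) (ho : IsInj o)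
      (step : (ρ i).Step o M) (rest : Derivation ρ M l F) : Derivation ρ N (i :: l) F

/-- No rule of the family can be applied to `N` at an injective occurrence. -/
def Terminal (ρ : ι → Rule.{u} AP AT) (N : PTNet.{u} AP AT) : Prop :=
  ∀ (i : ι) (o : (ρ i).L ⟶ N), IsInj o → ∀ M : PTNet.{u} AP AT, ¬ (ρ i).Step o M

/-- The transformation unit `N ⟹^{ρ!} F`: rules of the family are applied at injective
occurrences as long as possible; `l` records the rules that were applied. -/
def TransformationUnit (ρ : ι → Rule.{u} AP AT) (N : PTNet.{u} AP AT) (l : List ι)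
    (F : PTNet.{u} AP AT) : Prop :=
  Derivation ρ N l F ∧ Terminal ρ F

/-- The set `S` of pairs of a rule of the family and an injective occurrence of it in `N`. -/
structure Substitution (ρ : ι → Rule.{u} AP AT) (N : PTNet.{u} AP AT) : Type u where
  idx : ι
  occ : (ρ idx).L ⟶ N
  inj : IsInj occ

/-- The parallel transformation `N ⟹^{∑ s ∈ S} F` by all pairs `s = (ρ i, o)` in `S`: the double
pushout for the parallel rule `∐ Lₛ ⟵ ∐ Kₛ ⟶ ∐ Rₛ` (coproducts of nets) at the
occurrence `∐ Lₛ ⟶ N` induced by the `o`. -/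
def ParallelTransformation (ρ : ι → Rule.{u} AP AT) (N F : PTNet.{u} AP AT) : Prop :=
  ∃ (L : Limits.Cofan fun s : Substitution ρ N => (ρ s.idx).L)
    (K : Limits.Cofan fun s : Substitution ρ N => (ρ s.idx).K)
    (R : Limits.Cofan fun s : Substitution ρ N => (ρ s.idx).R)
    (l : K.pt ⟶ L.pt) (r : K.pt ⟶ R.pt) (o : L.pt ⟶ N),
    Nonempty (Limits.IsColimit L) ∧ Nonempty (Limits.IsColimit K) ∧
    Nonempty (Limits.IsColimit R) ∧
    (∀ s, K.inj s ≫ l = (ρ s.idx).l ≫ L.inj s) ∧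
    (∀ s, K.inj s ≫ r = (ρ s.idx).r ≫ R.inj s) ∧
    (∀ s, L.inj s ≫ o = s.occ) ∧
    DPO l r o F

/-- Parallel independence of two substitutions: `o₁(L₁) ∩ o₂(L₂) ⊆ o₁(l₁(K₁)) ∩ o₂(l₂(K₂))`,
for places and for transitions. -/
def ParallelIndependent {ρ : ι → Rule.{u} AP AT} {N : PTNet.{u} AP AT}
    (s₁ s₂ : Substitution ρ N) : Prop :=
  Set.range (Hom.fP s₁.occ) ∩ Set.range (Hom.fP s₂.occ) ⊆
      Set.range (Hom.fP ((ρ s₁.idx).l ≫ s₁.occ)) ∩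
        Set.range (Hom.fP ((ρ s₂.idx).l ≫ s₂.occ)) ∧
  Set.range (Hom.fT s₁.occ) ∩ Set.range (Hom.fT s₂.occ) ⊆
      Set.range (Hom.fT ((ρ s₁.idx).l ≫ s₁.occ)) ∩
        Set.range (Hom.fT ((ρ s₂.idx).l ≫ s₂.occ))

end Families

/-- The data that a reconfigurable net with substitutions has besides the net `N` and the
subnets: local name spaces, substitution transitions and local rules. -/
structure Layer (N : PTNet.{u} AP AT) where
  /-- local names of places -/
  nameP : Set AP
  /-- local names of transitions -/
  nameT : Set AT
  net_over : N.Over nameP nameT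
  /-- substitution transitions -/
  sT : Set N.T
  /-- names of substitution transitions -/
  nameST : Set AT
  nameST_subset : nameST ⊆ nameT
  tl_mem : ∀ t ∈ sT, N.tl t ∈ nameST
  tl_injOn : Set.InjOn N.tl sT
  tl_notMem : ∀ t ∉ sT, N.tl t ∉ nameST
  /-- names of connecting places -/
  nameCP : Set AP
  nameCP_subset : nameCP ⊆ nameP
  pl_mem : ∀ t ∈ sT, ∀ p ∈ N.adj t, N.pl p ∈ nameCP
  /-- local rules -/
  rules : Set (Rule.{u} AP AT)
  rules_over : ∀ ρ ∈ rules, ρ.Over nameP (nameT \ nameST)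

/-- Reconfigurable nets with substitutions, with underlying net `N`: to each substitution
transition `t` belong a net `SN t`, a strict embedding `emb t` of the connecting places
`CP(t)` into it, and the structure of a reconfigurable net with substitutions on `SN t`. -/
inductive SubstNet : PTNet.{u} AP AT → Type (max (u + 1) v w)
  | mk (N : PTNet.{u} AP AT) (lay : Layer N) (SN : lay.sT → PTNet.{u} AP AT)
      (emb : ∀ t : lay.sT, N.connOf t.1 ⟶ SN t) (emb_strict : ∀ t, IsStrict (emb t))
      (sub : ∀ t, SubstNet (SN t)) : SubstNet N

namespace SubstNet

def layer {N : PTNet.{u} AP AT} : SubstNet N → Layer N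
  | mk _ lay _ _ _ _ => lay

/-- The substitution rule `subst(t) = (Net(t) ⟵ CP(t) ⟶ SN t)`. -/
noncomputable def subst {N : PTNet.{u} AP AT} : (h : SubstNet N) → h.layer.sT → Rule.{u} AP AT
  | mk N _ SN emb emb_strict _, t =>
    { L := N.netOf t.1
      K := N.connOf t.1
      R := SN t
      l := N.connIncl t.1
      r := emb t
      l_strict := N.connIncl_isStrict t.1
      r_strict := emb_strict t }

/-- All substitution transitions, of the net itself and of its subnets at any depth:
`⟨t, none⟩` is the substitution transition `t` of the net itself, and `⟨t, some p⟩` is the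
substitution transition `p` inside the subnet that belongs to `t`. -/
def Pos : {N : PTNet.{u} AP AT} → SubstNet N → Type u
  | _, mk _ lay _ _ _ sub => Σ t : lay.sT, Option (Pos (sub t))

/-- The nesting depth of a substitution transition. -/
def depth : {N : PTNet.{u} AP AT} → (h : SubstNet N) → Pos h → ℕ
  | _, mk _ lay _ _ _ sub => fun (q : Σ t : lay.sT, Option (Pos (sub t))) =>
    match q with
    | ⟨_, none⟩ => 0
    | ⟨t, some p⟩ => depth (sub t) p + 1

/-- The substitution rule of a substitution transition at any depth. -/
noncomputable def rule : {N : PTNet.{u} AP AT} → (h : SubstNet N) → Pos h → Rule.{u} AP AT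
  | _, mk N lay SN emb emb_strict sub => fun (q : Σ t : lay.sT, Option (Pos (sub t))) =>
    match q with
    | ⟨t, none⟩ => (mk N lay SN emb emb_strict sub).subst t
    | ⟨t, some p⟩ => rule (sub t) p

/-- The substitution rules of depth `k`. -/
noncomputable def levelRule {N : PTNet.{u} AP AT} (h : SubstNet N) (k : ℕ)
    (p : {p : Pos h // depth h p = k}) : Rule.{u} AP AT :=
  rule h p.1

/-- The transition names used in the net and in its subnets at any depth. -/
def allNamesT : {N : PTNet.{u} AP AT} → SubstNet N → Set AT
  | _, mk _ lay _ _ _ sub => lay.nameT ∪ ⋃ t, allNamesT (sub t)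

/-- The conditions that relate the name spaces of the nets in the hierarchy: the names of the
connecting places of a net are place names of its subnets, and the local transition name spaces
of different nets have at most the greatest name in common, which is not the name of a
substitution transition. -/
def WellNamed [OrderTop AT] : {N : PTNet.{u} AP AT} → SubstNet N → Prop
  | _, mk N lay _ _ _ sub =>
    (∀ t ∈ lay.sT, N.tl t ≠ ⊤) ∧
    (∀ t, lay.nameCP ⊆ (sub t).layer.nameP) ∧
    (∀ t, lay.nameT ∩ allNamesT (sub t) ⊆ {⊤}) ∧
    (∀ t t', t ≠ t' → allNamesT (sub t) ∩ allNamesT (sub t') ⊆ {⊤}) ∧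
    ∀ t, WellNamed (sub t)

/-- `FlattenFrom h k M F`: flattening of a net `M` in which the substitution transitions of depth
less than `k` have been replaced already. If there are none of depth `k`, the result is `M`;
otherwise all of them are replaced by one parallel transformation, and the flattening goes on
with the substitution rules of the inserted subnets, which are those of depth `k + 1`. -/
inductive FlattenFrom {N : PTNet.{u} AP AT} (h : SubstNet N) :
    ℕ → PTNet.{u} AP AT → PTNet.{u} AP AT → Prop
  | done (k : ℕ) (M : PTNet.{u} AP AT) (hk : ∀ p, depth h p ≠ k) : FlattenFrom h k M M
  | next (k : ℕ) (M M' F : PTNet.{u} AP AT) (hk : ∃ p, depth h p = k)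
      (step : ParallelTransformation (levelRule h k) M M')
      (rest : FlattenFrom h (k + 1) M' F) : FlattenFrom h k M F

end SubstNet

/-- Hierarchical reconfigurable nets over the name spaces `AP` and `AT`. -/
structure HierarchicalNet (AP : Type v) (AT : Type w) [PartialOrder AP] [OrderTop AP]
    [PartialOrder AT] [OrderTop AT] where
  net : PTNet.{u} AP AT
  toSubst : SubstNet net
  wellNamed : toSubst.WellNamed
  /-- global rules -/
  globalRules : Set (Rule.{u} AP AT)

/-- `F` is a result of the (recursive) flattening of the hierarchical net. -/
def HierarchicalNet.Flatten [OrderTop AP] [OrderTop AT] (HN : HierarchicalNet.{u} AP AT)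
    (F : PTNet.{u} AP AT) : Prop :=
  HN.toSubst.FlattenFrom 0 HN.net F

end PTNet

/-! All the nets that arise are compared inside one ambient net. A `System` has a net `U` made of
`N` and the subnets inserted by all rules, glued along the connecting places, in which every
transition due for replacement is still present; each element records the net it comes from. If `A`
is the set of rules applied so far, the current net is a `Model` of `A`: it embeds strictly into
`U`, its elements come from `N` or from subnets of rules in `A`, and only the transitions replaced
by `A` are missing. The range of a strict embedding determines its source up to isomorphism, so the
order of replacement is irrelevant (`Model.nonempty_iso`). `Model.glue` carries models through a
simultaneous replacement, which covers direct steps and parallel transformations alike.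

Both processes end with every rule in `A`. In a maximal sequence no rule is used twice, since its
transition is gone from the model; each is used at least once, since a match of its left-hand side
survives all other steps and would contradict terminality (`TransformationUnit.mem_of_hierarchy`).
The sequence being a finite list, there are only finitely many rules, so `U` can be built with a
finite marking.

Symmetries are the delicate point: a left-hand side may have several injective occurrences at one
transition, permuting places, and a sequential result could depend on the choice. But all of them
belong to `S`, and a pushout cannot put two copies of a left-hand side on the same transition. So
the mere existence of the parallel result makes occurrences unique (`Rigid`, obtained in
`Model.parallel`), and the sequential side relies on this. -/

namespace PTNet

/-! ### Pushouts of nets, described elementwise. -/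

section Pushouts

variable {AP : Type v} {AT : Type w} [PartialOrder AP] [PartialOrder AT]

theorem hom_ext {M N : PTNet.{u} AP AT} {f g : M ⟶ N}
    (hP : ∀ x, Hom.fP f x = Hom.fP g x) (hT : ∀ x, Hom.fT f x = Hom.fT g x) : f = g :=
  Hom.ext (funext hP) (funext hT)

@[simp] theorem comp_fP {M N X : PTNet.{u} AP AT} (f : M ⟶ N) (g : N ⟶ X) (x : M.P) :
    Hom.fP (f ≫ g) x = Hom.fP g (Hom.fP f x) := rfl

@[simp] theorem comp_fT {M N X : PTNet.{u} AP AT} (f : M ⟶ N) (g : N ⟶ X) (x : M.T) :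
    Hom.fT (f ≫ g) x = Hom.fT g (Hom.fT f x) := rfl

theorem fP_congr {M N : PTNet.{u} AP AT} {f g : M ⟶ N} (h : f = g) (x : M.P) :
    Hom.fP f x = Hom.fP g x := by rw [h]

theorem fT_congr {M N : PTNet.{u} AP AT} {f g : M ⟶ N} (h : f = g) (x : M.T) :
    Hom.fT f x = Hom.fT g x := by rw [h]

theorem IsStrict.comp {M N X : PTNet.{u} AP AT} {f : M ⟶ N} {g : N ⟶ X} (hf : IsStrict f)
    (hg : IsStrict g) : IsStrict (f ≫ g) where
  inj := ⟨hg.inj.1.comp hf.inj.1, hg.inj.2.comp hf.inj.2⟩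
  pl_eq p := (hg.pl_eq _).trans (hf.pl_eq p)
  tl_eq t := (hg.tl_eq _).trans (hf.tl_eq t)
  mrk_eq p := (hf.mrk_eq p).trans (hg.mrk_eq _)

theorem isStrict_id (M : PTNet.{u} AP AT) : IsStrict (𝟙 M) :=
  ⟨⟨fun _ _ h => h, fun _ _ h => h⟩, fun _ => rfl, fun _ => rfl, fun _ => rfl⟩

/-- The inequalities on labels and marking hold for the inverse too, hence are equalities. This
allows gluing data to be transported along isomorphisms. -/
theorem iso_isStrict {M N : PTNet.{u} AP AT} (i : M ≅ N) : IsStrict i.hom := by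
  have hP : ∀ x, Hom.fP i.inv (Hom.fP i.hom x) = x := fun x => fP_congr i.hom_inv_id x
  have hT : ∀ x, Hom.fT i.inv (Hom.fT i.hom x) = x := fun x => fT_congr i.hom_inv_id x
  refine ⟨⟨Function.LeftInverse.injective hP, Function.LeftInverse.injective hT⟩, ?_, ?_, ?_⟩
  · intro p
    refine le_antisymm (Hom.map_pl i.hom p) ?_
    simpa only [hP] using Hom.map_pl i.inv (Hom.fP i.hom p)
  · intro t
    refine le_antisymm (Hom.map_tl i.hom t) ?_
    simpa only [hT] using Hom.map_tl i.inv (Hom.fT i.hom t)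
  · intro p
    refine le_antisymm (Hom.map_mrk i.hom p) ?_
    simpa only [hP] using Hom.map_mrk i.inv (Hom.fP i.hom p)

/-- A morphism into `U` whose range lies in that of a strict morphism factors through it. -/
theorem exists_lift {M X U : PTNet.{u} AP AT} {e : M ⟶ U} (he : IsStrict e) (o : X ⟶ U)
    (hP : ∀ x, ∃ y, Hom.fP e y = Hom.fP o x) (hT : ∀ x, ∃ y, Hom.fT e y = Hom.fT o x) :
    ∃ o' : X ⟶ M, o' ≫ e = o := by
  choose a ha using hP
  choose b hb using hT
  have hea : Hom.fP e ∘ a = Hom.fP o := funext ha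
  let f : Hom X M :=
    { fP := a
      fT := b
      map_pre := fun t => by
        apply Finsupp.mapDomain_injective he.inj.1
        rw [← Hom.map_pre e, hb, Hom.map_pre o, ← Finsupp.mapDomain_comp, hea]
      map_post := fun t => by
        apply Finsupp.mapDomain_injective he.inj.1
        rw [← Hom.map_post e, hb, Hom.map_post o, ← Finsupp.mapDomain_comp, hea]
      map_mrk := fun p => by
        rw [he.mrk_eq, ha]
        exact Hom.map_mrk o p
      map_pl := fun p => by
        rw [← he.pl_eq, ha]
        exact Hom.map_pl o p
      map_tl := fun t => by
        rw [← he.tl_eq, hb]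
        exact Hom.map_tl o t }
  exact ⟨f, hom_ext ha hb⟩

theorem IsStrict.of_comp {M N X : PTNet.{u} AP AT} {f : M ⟶ N} {g : N ⟶ X} (hg : IsStrict g)
    (h : IsStrict (f ≫ g)) : IsStrict f where
  inj := ⟨Function.Injective.of_comp (f := Hom.fP g) h.inj.1,
    Function.Injective.of_comp (f := Hom.fT g) h.inj.2⟩
  pl_eq p := (hg.pl_eq _).symm.trans (h.pl_eq p)
  tl_eq t := (hg.tl_eq _).symm.trans (h.tl_eq t)
  mrk_eq p := (h.mrk_eq p).trans (hg.mrk_eq _).symm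

theorem IsStrict.cancel {M N X : PTNet.{u} AP AT} {f f' : M ⟶ N} {g : N ⟶ X} (hg : IsStrict g)
    (h : f ≫ g = f' ≫ g) : f = f' :=
  hom_ext (fun x => hg.inj.1 (fP_congr h x)) (fun x => hg.inj.2 (fT_congr h x))

variable {S : Type u} {K R : S → PTNet.{u} AP AT} {D M M' : PTNet.{u} AP AT}

/-- The simultaneous pushout of a family of spans `R s ⟵ K s ⟶ D`. -/
structure IsWidePushout (r : ∀ s, K s ⟶ R s) (k : ∀ s, K s ⟶ D) (n : ∀ s, R s ⟶ M)
    (h : D ⟶ M) : Prop where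
  w : ∀ s, r s ≫ n s = k s ≫ h
  desc : ∀ {X : PTNet.{u} AP AT} (a : ∀ s, R s ⟶ X) (b : D ⟶ X),
    (∀ s, r s ≫ a s = k s ≫ b) → ∃ x : M ⟶ X, (∀ s, n s ≫ x = a s) ∧ h ≫ x = b
  ext : ∀ {X : PTNet.{u} AP AT} (x y : M ⟶ X),
    (∀ s, n s ≫ x = n s ≫ y) → h ≫ x = h ≫ y → x = y

theorem IsWidePushout.exists_iso {r : ∀ s, K s ⟶ R s} {k : ∀ s, K s ⟶ D} {n : ∀ s, R s ⟶ M}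
    {h : D ⟶ M} {n' : ∀ s, R s ⟶ M'} {h' : D ⟶ M'} (H : IsWidePushout r k n h)
    (H' : IsWidePushout r k n' h') :
    ∃ i : M ≅ M', (∀ s, n s ≫ i.hom = n' s) ∧ h ≫ i.hom = h' := by
  obtain ⟨a, ha, ha'⟩ := H.desc n' h' H'.w
  obtain ⟨b, hb, hb'⟩ := H'.desc n h H.w
  refine ⟨⟨a, b, H.ext _ _ (fun s => ?_) ?_, H'.ext _ _ (fun s => ?_) ?_⟩, ha, ha'⟩
  · rw [← Category.assoc, ha, hb, Category.comp_id]
  · rw [← Category.assoc, ha', hb', Category.comp_id]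
  · rw [← Category.assoc, hb, ha, Category.comp_id]
  · rw [← Category.assoc, hb', ha', Category.comp_id]

theorem isWidePushout_of_isPushout {K R : PTNet.{u} AP AT} {r : K ⟶ R} {k : K ⟶ D} {n : R ⟶ M}
    {h : D ⟶ M} (H : IsPushout r k n h) :
    IsWidePushout (S := PUnit.{u + 1}) (fun _ => r) (fun _ => k) (fun _ => n) h where
  w _ := H.w
  desc a b hab := ⟨H.desc (a ⟨⟩) b (hab ⟨⟩), fun _ => H.inl_desc _ _ _, H.inr_desc _ _ _⟩
  ext _ _ hn hh := H.hom_ext (hn ⟨⟩) hh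

theorem IsWidePushout.isPushout {K R : PTNet.{u} AP AT} {r : K ⟶ R} {k : K ⟶ D} {n : R ⟶ M}
    {h : D ⟶ M}
    (H : IsWidePushout (S := PUnit.{u + 1}) (fun _ => r) (fun _ => k) (fun _ => n) h) :
    IsPushout r k n h := by
  have hd : ∀ s : Limits.PushoutCocone r k,
      ∃ x : M ⟶ s.pt, n ≫ x = s.inl ∧ h ≫ x = s.inr := fun s => by
    obtain ⟨x, hx, hx'⟩ := H.desc (fun _ => s.inl) s.inr (fun _ => s.condition)
    exact ⟨x, hx ⟨⟩, hx'⟩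
  choose d hd₁ hd₂ using hd
  exact ⟨⟨H.w ⟨⟩⟩, ⟨Limits.PushoutCocone.IsColimit.mk (H.w ⟨⟩) d hd₁ hd₂ fun s m h₁ h₂ =>
    H.ext _ _ (fun _ => h₁.trans (hd₁ s).symm) (h₂.trans (hd₂ s).symm)⟩⟩

/-- A pushout of a coproduct of spans is a simultaneous pushout of the spans. -/
theorem isWidePushout_of_coproduct {r : ∀ s, K s ⟶ R s} (cK : Limits.Cofan K)
    (cR : Limits.Cofan R) (hK : Limits.IsColimit cK) (hR : Limits.IsColimit cR)
    {r' : cK.pt ⟶ cR.pt} (hr : ∀ s, cK.inj s ≫ r' = r s ≫ cR.inj s) {k : cK.pt ⟶ D}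
    {n : cR.pt ⟶ M} {h : D ⟶ M} (H : IsPushout r' k n h) :
    IsWidePushout r (fun s => cK.inj s ≫ k) (fun s => cR.inj s ≫ n) h where
  w s := by rw [← Category.assoc, ← hr, Category.assoc, H.w, Category.assoc]
  desc a b hab := by
    have hc : ∀ s, cR.inj s ≫ Limits.Cofan.IsColimit.desc hR a = a s := fun s =>
      Limits.Cofan.IsColimit.fac hR a s
    refine ⟨H.desc (Limits.Cofan.IsColimit.desc hR a) b
      (Limits.Cofan.IsColimit.hom_ext hK _ _ fun s => ?_), fun s => ?_, H.inr_desc _ _ _⟩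
    · rw [← Category.assoc, hr, Category.assoc, hc, hab, Category.assoc]
    · rw [Category.assoc, H.inl_desc, hc]
  ext x y hn hh := by
    refine H.hom_ext (Limits.Cofan.IsColimit.hom_ext hR _ _ fun s => ?_) hh
    simpa only [Category.assoc] using hn s

/-- An elementwise description of simultaneous pushouts of spans `R s ⟵ K s ⟶ D` where `K s` has
no transitions: `M` consists of `D` and of copies of the parts of `R s` outside `K s`. -/
structure IsGluing (r : ∀ s, K s ⟶ R s) (k : ∀ s, K s ⟶ D) (n : ∀ s, R s ⟶ M)
    (h : D ⟶ M) : Prop where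
  w : ∀ s, r s ≫ n s = k s ≫ h
  strict : IsStrict h
  cover_P : ∀ m, (∃ y, Hom.fP h y = m) ∨ ∃ s x, Hom.fP (n s) x = m
  cover_T : ∀ m, (∃ y, Hom.fT h y = m) ∨ ∃ s x, Hom.fT (n s) x = m
  inter_P : ∀ s x y, Hom.fP (n s) x = Hom.fP h y → ∃ z, Hom.fP (r s) z = x
  inter_T : ∀ s x y, Hom.fT (n s) x ≠ Hom.fT h y
  inj_P : ∀ s x s' x', Hom.fP (n s) x = Hom.fP (n s') x' →
    (∃ y, Hom.fP h y = Hom.fP (n s) x) ∨ (⟨s, x⟩ : Σ s, (R s).P) = ⟨s', x'⟩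
  inj_T : ∀ s x s' x', Hom.fT (n s) x = Hom.fT (n s') x' →
    (⟨s, x⟩ : Σ s, (R s).T) = ⟨s', x'⟩
  pl_eq : ∀ s x, (∀ z, Hom.fP (r s) z ≠ x) → M.pl (Hom.fP (n s) x) = (R s).pl x
  mrk_eq : ∀ s x, (∀ z, Hom.fP (r s) z ≠ x) → (R s).mrk x = M.mrk (Hom.fP (n s) x)
  tl_eq : ∀ s x, M.tl (Hom.fT (n s) x) = (R s).tl x

/-- The given maps on `D` and the `R s` overlap only over the interface, where the cocone condition
makes them agree. Outside `D`, labels and marking of `M` are exactly those of `R s`, so the required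
inequalities are inherited. -/
theorem IsGluing.isWidePushout {r : ∀ s, K s ⟶ R s} {k : ∀ s, K s ⟶ D} {n : ∀ s, R s ⟶ M}
    {h : D ⟶ M} (H : IsGluing r k n h) : IsWidePushout r k n h where
  w := H.w
  ext x y hn hh := by
    refine hom_ext (fun m => ?_) fun m => ?_
    · obtain ⟨y, rfl⟩ | ⟨s, y, rfl⟩ := H.cover_P m
      exacts [fP_congr hh y, fP_congr (hn s) y]
    · obtain ⟨y, rfl⟩ | ⟨s, y, rfl⟩ := H.cover_T m
      exacts [fT_congr hh y, fT_congr (hn s) y]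
  desc {X} a b hab := by
    have hP : ∀ m, ∃ v : X.P, (∀ y, Hom.fP h y = m → Hom.fP b y = v) ∧
        ∀ s x, Hom.fP (n s) x = m → Hom.fP (a s) x = v := by
      intro m
      by_cases hm : ∃ y, Hom.fP h y = m
      · obtain ⟨y, rfl⟩ := hm
        refine ⟨Hom.fP b y, fun y' hy' => by rw [H.strict.inj.1 hy'], fun s x hx => ?_⟩
        obtain ⟨z, rfl⟩ := H.inter_P s x y hx
        have hz : Hom.fP (k s) z = y := H.strict.inj.1 ((fP_congr (H.w s) z).symm.trans hx)
        rw [← hz]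
        exact fP_congr (hab s) z
      · obtain hm' | ⟨s, x, rfl⟩ := H.cover_P m
        · exact absurd hm' hm
        refine ⟨Hom.fP (a s) x, fun y hy => absurd ⟨y, hy⟩ hm, fun s' x' hx => ?_⟩
        obtain h1 | h1 := H.inj_P _ _ _ _ hx.symm
        · exact absurd h1 hm
        · cases h1
          rfl
    have hT : ∀ m, ∃ v : X.T, (∀ y, Hom.fT h y = m → Hom.fT b y = v) ∧
        ∀ s x, Hom.fT (n s) x = m → Hom.fT (a s) x = v := by
      intro m
      obtain ⟨y, rfl⟩ | ⟨s, x, rfl⟩ := H.cover_T m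
      · exact ⟨Hom.fT b y, fun y' hy' => by rw [H.strict.inj.2 hy'],
          fun s x hx => absurd hx (H.inter_T s x y)⟩
      · refine ⟨Hom.fT (a s) x, fun y hy => absurd hy.symm (H.inter_T s x y), fun s' x' hx => ?_⟩
        cases H.inj_T _ _ _ _ hx
        rfl
    choose fP hPb hPa using hP
    choose fT hTb hTa using hT
    have hb : ∀ y, fP (Hom.fP h y) = Hom.fP b y := fun y => (hPb _ y rfl).symm
    have ha : ∀ s y, fP (Hom.fP (n s) y) = Hom.fP (a s) y := fun s y => (hPa _ s y rfl).symm
    have hb' : ∀ y, fT (Hom.fT h y) = Hom.fT b y := fun y => (hTb _ y rfl).symm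
    have ha' : ∀ s y, fT (Hom.fT (n s) y) = Hom.fT (a s) y := fun s y => (hTa _ s y rfl).symm
    have hbc : fP ∘ Hom.fP h = Hom.fP b := funext hb
    have hac : ∀ s, fP ∘ Hom.fP (n s) = Hom.fP (a s) := fun s => funext (ha s)
    let x : Hom M X :=
      { fP := fP
        fT := fT
        map_pre := fun t => by
          obtain ⟨y, rfl⟩ | ⟨s, y, rfl⟩ := H.cover_T t
          · rw [hb', Hom.map_pre b, Hom.map_pre h, ← Finsupp.mapDomain_comp, hbc]
          · rw [ha', Hom.map_pre (a s), Hom.map_pre (n s), ← Finsupp.mapDomain_comp, hac]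
        map_post := fun t => by
          obtain ⟨y, rfl⟩ | ⟨s, y, rfl⟩ := H.cover_T t
          · rw [hb', Hom.map_post b, Hom.map_post h, ← Finsupp.mapDomain_comp, hbc]
          · rw [ha', Hom.map_post (a s), Hom.map_post (n s), ← Finsupp.mapDomain_comp, hac]
        map_mrk := fun p => by
          by_cases hp : ∃ y, Hom.fP h y = p
          · obtain ⟨y, rfl⟩ := hp
            rw [hb, ← H.strict.mrk_eq]
            exact Hom.map_mrk b y
          · obtain hp' | ⟨s, y, rfl⟩ := H.cover_P p
            · exact absurd hp' hp
            rw [ha, ← H.mrk_eq]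
            · exact Hom.map_mrk (a s) y
            · rintro z rfl
              exact hp ⟨_, (fP_congr (H.w s) z).symm⟩
        map_pl := fun p => by
          by_cases hp : ∃ y, Hom.fP h y = p
          · obtain ⟨y, rfl⟩ := hp
            rw [hb, H.strict.pl_eq]
            exact Hom.map_pl b y
          · obtain hp' | ⟨s, y, rfl⟩ := H.cover_P p
            · exact absurd hp' hp
            rw [ha, H.pl_eq]
            · exact Hom.map_pl (a s) y
            · rintro z rfl
              exact hp ⟨_, (fP_congr (H.w s) z).symm⟩
        map_tl := fun t => by
          obtain ⟨y, rfl⟩ | ⟨s, y, rfl⟩ := H.cover_T t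
          · rw [hb', H.strict.tl_eq]
            exact Hom.map_tl b y
          · rw [ha', H.tl_eq]
            exact Hom.map_tl (a s) y }
    exact ⟨x, fun s => hom_ext (ha s) (ha' s), hom_ext hb hb'⟩

theorem IsGluing.comp_iso {r : ∀ s, K s ⟶ R s} {k : ∀ s, K s ⟶ D} {n : ∀ s, R s ⟶ M}
    {h : D ⟶ M} {n' : ∀ s, R s ⟶ M'} {h' : D ⟶ M'} (H : IsGluing r k n h) (i : M ≅ M')
    (hn : ∀ s, n s ≫ i.hom = n' s) (hh : h ≫ i.hom = h') : IsGluing r k n' h' := by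
  have hi := iso_isStrict i
  have hP : ∀ m, ∃ y, Hom.fP i.hom y = m := fun m => ⟨_, fP_congr i.inv_hom_id m⟩
  have hT : ∀ m, ∃ y, Hom.fT i.hom y = m := fun m => ⟨_, fT_congr i.inv_hom_id m⟩
  obtain rfl : (fun s => n s ≫ i.hom) = n' := funext hn
  subst hh
  refine ⟨fun s => ?_, H.strict.comp hi, fun m => ?_, fun m => ?_, fun s x y hxy => ?_,
    fun s x y hxy => ?_, fun s x s' x' hx => ?_, fun s x s' x' hx => ?_, fun s x hx => ?_,
    fun s x hx => ?_, fun s x => ?_⟩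
  · rw [← Category.assoc, H.w, Category.assoc]
  · obtain ⟨m, rfl⟩ := hP m
    obtain ⟨y, rfl⟩ | ⟨s, y, rfl⟩ := H.cover_P m
    exacts [Or.inl ⟨y, rfl⟩, Or.inr ⟨s, y, rfl⟩]
  · obtain ⟨m, rfl⟩ := hT m
    obtain ⟨y, rfl⟩ | ⟨s, y, rfl⟩ := H.cover_T m
    exacts [Or.inl ⟨y, rfl⟩, Or.inr ⟨s, y, rfl⟩]
  · exact H.inter_P s x y (hi.inj.1 hxy)
  · exact H.inter_T s x y (hi.inj.2 hxy)
  · refine (H.inj_P s x s' x' (hi.inj.1 hx)).imp_left ?_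
    rintro ⟨y, hy⟩
    exact ⟨y, by simp [hy]⟩
  · exact H.inj_T s x s' x' (hi.inj.2 hx)
  · exact (hi.pl_eq _).trans (H.pl_eq s x hx)
  · exact (H.mrk_eq s x hx).trans (hi.mrk_eq _)
  · exact (hi.tl_eq _).trans (H.tl_eq s x)

open Classical in
/-- The image in the glued net of a place of `R s`. -/
noncomputable def gluePlace (r : ∀ s, K s ⟶ R s) (k : ∀ s, K s ⟶ D) (s : S) (x : (R s).P) :
    D.P ⊕ Σ s, {x : (R s).P // ∀ z, Hom.fP (r s) z ≠ x} :=
  if hx : ∃ z, Hom.fP (r s) z = x then Sum.inl (Hom.fP (k s) hx.choose)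
  else Sum.inr ⟨s, x, not_exists.1 hx⟩

theorem gluePlace_map {r : ∀ s, K s ⟶ R s} (k : ∀ s, K s ⟶ D) {s : S} (hr : IsStrict (r s))
    (z : (K s).P) : gluePlace r k s (Hom.fP (r s) z) = Sum.inl (Hom.fP (k s) z) := by
  have hx : ∃ z', Hom.fP (r s) z' = Hom.fP (r s) z := ⟨z, rfl⟩
  rw [gluePlace, dif_pos hx, hr.inj.1 hx.choose_spec]

theorem gluePlace_of_ne {r : ∀ s, K s ⟶ R s} (k : ∀ s, K s ⟶ D) {s : S} {x : (R s).P}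
    (hx : ∀ z, Hom.fP (r s) z ≠ x) : gluePlace r k s x = Sum.inr ⟨s, x, hx⟩ :=
  dif_neg (not_exists.2 hx)

/-- The spans `R s ⟵ K s` add only finitely many tokens. -/
def FiniteTokens (r : ∀ s, K s ⟶ R s) : Prop :=
  {q : Σ s, {x : (R s).P // ∀ z, Hom.fP (r s) z ≠ x} | (R q.1).mrk q.2.1 ≠ 0}.Finite

theorem finiteTokens_of_finite [Finite S] (r : ∀ s, K s ⟶ R s) : FiniteTokens r := by
  have h : ∀ s, {x : {x : (R s).P // ∀ z, Hom.fP (r s) z ≠ x} | (R s).mrk x.1 ≠ 0}.Finite :=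
    fun s => ((R s).mrk.hasFiniteSupport).preimage Subtype.val_injective.injOn
  refine (Set.finite_iUnion fun s => (h s).image (Sigma.mk s)).subset ?_
  rintro ⟨s, x⟩ hx
  exact Set.mem_iUnion.2 ⟨s, x, hx, rfl⟩

/-- Meant for left legs of rules, at a stage where the set of occurrences is not yet known to be
finite. -/
theorem finiteTokens_of_surjective {r : ∀ s, K s ⟶ R s}
    (hr : ∀ s, Function.Surjective (Hom.fP (r s))) : FiniteTokens r := by
  refine Set.Finite.subset Set.finite_empty ?_
  rintro ⟨s, x, hx⟩ -
  obtain ⟨z, hz⟩ := hr s x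
  exact hx z hz

/-- The net that consists of `D` and of the parts of all `R s` outside `K s`. -/
noncomputable def glue {r : ∀ s, K s ⟶ R s} (k : ∀ s, K s ⟶ D) (hf : FiniteTokens r) :
    PTNet.{u} AP AT where
  P := D.P ⊕ Σ s, {x : (R s).P // ∀ z, Hom.fP (r s) z ≠ x}
  T := D.T ⊕ Σ s, (R s).T
  pre := Sum.elim (fun t => (D.pre t).mapDomain Sum.inl)
    fun q => ((R q.1).pre q.2).mapDomain (gluePlace r k q.1)
  post := Sum.elim (fun t => (D.post t).mapDomain Sum.inl)
    fun q => ((R q.1).post q.2).mapDomain (gluePlace r k q.1)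
  pl := Sum.elim D.pl fun q => (R q.1).pl q.2.1
  tl := Sum.elim D.tl fun q => (R q.1).tl q.2
  mrk := Finsupp.ofSupportFinite (Sum.elim D.mrk fun q => (R q.1).mrk q.2.1) (by
    refine ((D.mrk.hasFiniteSupport.image Sum.inl).union (hf.image Sum.inr)).subset ?_
    rintro (x | q) hx
    exacts [Or.inl ⟨x, hx, rfl⟩, Or.inr ⟨q, hx, rfl⟩])

/-- The inclusion of `D` into the glued net. -/
noncomputable def glueBase {r : ∀ s, K s ⟶ R s} (k : ∀ s, K s ⟶ D) (hf : FiniteTokens r) :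
    D ⟶ glue k hf :=
  ({ fP := Sum.inl
     fT := Sum.inl
     map_pre := fun _ => rfl
     map_post := fun _ => rfl
     map_mrk := fun _ => le_rfl
     map_pl := fun _ => le_rfl
     map_tl := fun _ => le_rfl } : Hom D (glue k hf))

/-- The morphism from `R s` to the glued net. -/
noncomputable def gluePart {r : ∀ s, K s ⟶ R s} (hr : ∀ s, IsStrict (r s)) (k : ∀ s, K s ⟶ D)
    (hf : FiniteTokens r) (s : S) : R s ⟶ glue k hf :=
  ({ fP := gluePlace r k s
     fT := fun t => Sum.inr ⟨s, t⟩
     map_pre := fun _ => rfl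
     map_post := fun _ => rfl
     map_mrk := fun p => by
      by_cases hp : ∃ z, Hom.fP (r s) z = p
      · obtain ⟨z, rfl⟩ := hp
        rw [gluePlace_map k (hr s), ← (hr s).mrk_eq]
        exact Hom.map_mrk (k s) z
      · rw [gluePlace_of_ne k (not_exists.1 hp)]
        exact le_rfl
     map_pl := fun p => by
      by_cases hp : ∃ z, Hom.fP (r s) z = p
      · obtain ⟨z, rfl⟩ := hp
        rw [gluePlace_map k (hr s), (hr s).pl_eq]
        exact Hom.map_pl (k s) z
      · rw [gluePlace_of_ne k (not_exists.1 hp)]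
        exact le_rfl
     map_tl := fun _ => le_rfl } : Hom (R s) (glue k hf))

theorem isGluing_glue {r : ∀ s, K s ⟶ R s} (hr : ∀ s, IsStrict (r s)) (k : ∀ s, K s ⟶ D)
    (hK : ∀ s, IsEmpty (K s).T) (hf : FiniteTokens r) :
    IsGluing r k (gluePart hr k hf) (glueBase k hf) where
  w s := hom_ext (fun z => gluePlace_map k (hr s) z) fun z => (hK s).elim z
  strict := ⟨⟨Sum.inl_injective, Sum.inl_injective⟩, fun _ => rfl, fun _ => rfl, fun _ => rfl⟩
  cover_P := by
    rintro (y | ⟨s, x, hx⟩)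
    exacts [Or.inl ⟨y, rfl⟩, Or.inr ⟨s, x, gluePlace_of_ne k hx⟩]
  cover_T := by
    rintro (y | ⟨s, x⟩)
    exacts [Or.inl ⟨y, rfl⟩, Or.inr ⟨s, x, rfl⟩]
  inter_P s x y hxy := by
    by_contra hx
    have h1 : gluePlace r k s x = Sum.inl y := hxy
    rw [gluePlace_of_ne k (not_exists.1 hx)] at h1
    cases h1
  inter_T s x y := Sum.inr_ne_inl
  inj_P s x s' x' hxx := by
    have h1 : gluePlace r k s x = gluePlace r k s' x' := hxx
    by_cases hx : ∃ z, Hom.fP (r s) z = x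
    · obtain ⟨z, rfl⟩ := hx
      exact Or.inl ⟨_, (gluePlace_map k (hr s) z).symm⟩
    by_cases hx' : ∃ z, Hom.fP (r s') z = x'
    · obtain ⟨z, rfl⟩ := hx'
      exact Or.inl ⟨_, (gluePlace_map k (hr s') z).symm.trans h1.symm⟩
    rw [gluePlace_of_ne k (not_exists.1 hx), gluePlace_of_ne k (not_exists.1 hx')] at h1
    cases h1
    exact Or.inr rfl
  inj_T s x s' x' hxx := Sum.inr_injective hxx
  pl_eq s x hx := by
    have h1 : Hom.fP (gluePart hr k hf s) x = Sum.inr ⟨s, x, hx⟩ := gluePlace_of_ne k hx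
    rw [h1]
    rfl
  mrk_eq s x hx := by
    have h1 : Hom.fP (gluePart hr k hf s) x = Sum.inr ⟨s, x, hx⟩ := gluePlace_of_ne k hx
    rw [h1]
    rfl
  tl_eq s x := rfl

/-- The explicit net `glue` is a simultaneous pushout, and these are unique up to isomorphism, so
any other one inherits its description. The hypothesis `hf` serves to give `glue` a finite marking.
-/
theorem IsWidePushout.isGluing {r : ∀ s, K s ⟶ R s} {k : ∀ s, K s ⟶ D} {n : ∀ s, R s ⟶ M}
    {h : D ⟶ M} (H : IsWidePushout r k n h) (hr : ∀ s, IsStrict (r s))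
    (hK : ∀ s, IsEmpty (K s).T) (hf : FiniteTokens r) : IsGluing r k n h := by
  have G := isGluing_glue hr k hK hf
  obtain ⟨i, hi, hi'⟩ := G.isWidePushout.exists_iso H
  exact G.comp_iso i hi hi'

/-- The morphisms `n s` of a gluing are injective if the `k s` are. -/
theorem IsGluing.isInj {r : ∀ s, K s ⟶ R s} {k : ∀ s, K s ⟶ D} {n : ∀ s, R s ⟶ M}
    {h : D ⟶ M} (H : IsGluing r k n h) {s : S} (hk : IsInj (k s)) : IsInj (n s) := by
  constructor
  · intro x x' hx
    obtain ⟨y, hy⟩ | h1 := H.inj_P _ _ _ _ hx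
    · obtain ⟨z, rfl⟩ := H.inter_P _ _ _ hy.symm
      obtain ⟨z', rfl⟩ := H.inter_P _ _ _ (hx.symm.trans hy.symm)
      have h2 := (fP_congr (H.w s) z).symm.trans (hx.trans (fP_congr (H.w s) z'))
      rw [hk.1 (H.strict.inj.1 h2)]
    · cases h1
      rfl
  · intro x x' hx
    cases H.inj_T _ _ _ _ hx
    rfl

theorem IsGluing.isStrict {r : ∀ s, K s ⟶ R s} {k : ∀ s, K s ⟶ D} {n : ∀ s, R s ⟶ M}
    {h : D ⟶ M} (H : IsGluing r k n h) {s : S} (hr : IsStrict (r s)) (hk : IsStrict (k s)) :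
    IsStrict (n s) := by
  have hw : ∀ z, Hom.fP (n s) (Hom.fP (r s) z) = Hom.fP h (Hom.fP (k s) z) := fP_congr (H.w s)
  refine ⟨H.isInj hk.inj, fun x => ?_, H.tl_eq s, fun x => ?_⟩ <;>
    by_cases hx : ∃ z, Hom.fP (r s) z = x
  · obtain ⟨z, rfl⟩ := hx
    rw [hw, H.strict.pl_eq, hk.pl_eq, hr.pl_eq]
  · exact H.pl_eq s x (not_exists.1 hx)
  · obtain ⟨z, rfl⟩ := hx
    rw [hw, ← H.strict.mrk_eq, ← hk.mrk_eq, ← hr.mrk_eq]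
  · exact H.mrk_eq s x (not_exists.1 hx)

end Pushouts

/-! ### Matches of replacement rules and their survival. -/

section Matches

variable {AP : Type v} {AT : Type w} [PartialOrder AP] [PartialOrder AT]

/-- Injective net morphisms that preserve the labels of transitions exactly. -/
structure IsMatch {M N : PTNet.{u} AP AT} (f : M ⟶ N) : Prop where
  inj : IsInj f
  tl_eq : ∀ t, N.tl (Hom.fT f t) = M.tl t

theorem IsStrict.isMatch {M N : PTNet.{u} AP AT} {f : M ⟶ N} (h : IsStrict f) : IsMatch f :=
  ⟨h.inj, h.tl_eq⟩

theorem IsMatch.comp {M N X : PTNet.{u} AP AT} {f : M ⟶ N} {g : N ⟶ X} (hf : IsMatch f)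
    (hg : IsMatch g) : IsMatch (f ≫ g) :=
  ⟨⟨hg.inj.1.comp hf.inj.1, hg.inj.2.comp hf.inj.2⟩, fun t => (hg.tl_eq _).trans (hf.tl_eq t)⟩

/-- The net `N` without the transition `t`. -/
noncomputable def erase (N : PTNet.{u} AP AT) (t : N.T) : PTNet.{u} AP AT where
  P := N.P
  T := {x : N.T // x ≠ t}
  pre x := N.pre x.1
  post x := N.post x.1
  pl := N.pl
  tl x := N.tl x.1
  mrk := N.mrk

/-- The inclusion of the net without the transition `t`. -/
noncomputable def eraseIncl (N : PTNet.{u} AP AT) (t : N.T) : N.erase t ⟶ N :=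
  ({ fP := id
     fT := Subtype.val
     map_pre := fun _ => Finsupp.mapDomain_id.symm
     map_post := fun _ => Finsupp.mapDomain_id.symm
     map_mrk := fun _ => le_rfl
     map_pl := fun _ => le_rfl
     map_tl := fun _ => le_rfl } : Hom (N.erase t) N)

theorem eraseIncl_isStrict (N : PTNet.{u} AP AT) (t : N.T) : IsStrict (N.eraseIncl t) :=
  ⟨⟨fun _ _ h => h, Subtype.val_injective⟩, fun _ => rfl, fun _ => rfl, fun _ => rfl⟩

/-- Rules that replace a single transition and keep its adjacent places. -/
structure Rule.IsReplacement (ρ : Rule.{u} AP AT) : Prop where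
  isEmpty : IsEmpty ρ.K.T
  surj : Function.Surjective (Hom.fP ρ.l)
  single : ∃ t : ρ.L.T, ∀ t', t' = t
  adj : ∀ t x, x ∈ ρ.L.adj t

theorem Rule.IsReplacement.subsingleton {ρ : Rule.{u} AP AT} (hρ : ρ.IsReplacement)
    (t t' : ρ.L.T) : t = t' := by
  obtain ⟨t₀, h₀⟩ := hρ.single
  rw [h₀ t, h₀ t']

theorem Rule.Step.exists_isGluing {ρ : Rule.{u} AP AT} (hρ : ρ.IsReplacement)
    {N M : PTNet.{u} AP AT} {o : ρ.L ⟶ N} (H : ρ.Step o M) :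
    ∃ (D : PTNet.{u} AP AT) (k : ρ.K ⟶ D) (g : D ⟶ N) (n : ρ.R ⟶ M) (h : D ⟶ M),
      IsGluing (S := PUnit.{u + 1}) (fun _ => ρ.l) (fun _ => k) (fun _ => o) g ∧
      IsGluing (S := PUnit.{u + 1}) (fun _ => ρ.r) (fun _ => k) (fun _ => n) h := by
  obtain ⟨D, k, g, n, h, h₁, h₂⟩ := H
  exact ⟨D, k, g, n, h,
    (isWidePushout_of_isPushout h₁).isGluing (fun _ => ρ.l_strict) (fun _ => hρ.isEmpty)
      (finiteTokens_of_finite _),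
    (isWidePushout_of_isPushout h₂).isGluing (fun _ => ρ.r_strict) (fun _ => hρ.isEmpty)
      (finiteTokens_of_finite _)⟩

/-- The pushout complement is `N` without the image transition. All places of `ρ.L` come from the
interface, so only the transition label has to be exact; place labels and tokens may change. -/
theorem IsMatch.exists_step {ρ : Rule.{u} AP AT} (hρ : ρ.IsReplacement) {N : PTNet.{u} AP AT}
    {o : ρ.L ⟶ N} (ho : IsMatch o) : ∃ M, ρ.Step o M := by
  obtain ⟨t₀, h₀⟩ := hρ.single
  have hE := eraseIncl_isStrict N (Hom.fT o t₀)
  have hE' : ∀ x : N.P, ∃ y, Hom.fP (N.eraseIncl (Hom.fT o t₀)) y = x := fun x => ⟨x, rfl⟩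
  obtain ⟨k, hk⟩ := exists_lift hE (ρ.l ≫ o) (fun x => hE' _)
    fun x => hρ.isEmpty.elim x
  have h₁ : IsGluing (S := PUnit.{u + 1}) (fun _ => ρ.l) (fun _ => k) (fun _ => o)
      (N.eraseIncl (Hom.fT o t₀)) := by
    refine ⟨fun _ => hk.symm, hE, fun m => Or.inl ⟨m, rfl⟩, fun m => ?_, fun _ x _ _ => hρ.surj x,
      fun _ x y hxy => ?_, fun _ x _ _ _ => Or.inl (hE' _), fun _ x _ x' _ => ?_,
      fun _ x hx => ?_, fun _ x hx => ?_, fun _ => ho.tl_eq⟩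
    · by_cases hm : m = Hom.fT o t₀
      · exact Or.inr ⟨⟨⟩, t₀, hm.symm⟩
      · exact Or.inl ⟨⟨m, hm⟩, rfl⟩
    · rw [h₀ x] at hxy
      exact y.2 hxy.symm
    · rw [hρ.subsingleton x x']
    · obtain ⟨z, hz⟩ := hρ.surj x
      exact absurd hz (hx z)
    · obtain ⟨z, hz⟩ := hρ.surj x
      exact absurd hz (hx z)
  have h₂ := isGluing_glue (S := PUnit.{u + 1}) (fun _ => ρ.r_strict) (fun _ => k)
    (fun _ => hρ.isEmpty) (finiteTokens_of_finite _)
  exact ⟨_, _, k, _, _, _, h₁.isWidePushout.isPushout,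
    IsWidePushout.isPushout (n := gluePart (fun _ => ρ.r_strict) _ _ PUnit.unit.{u + 1}) h₂.isWidePushout⟩

/-- The right-hand side of an applied rule is matched in the result. -/
theorem Rule.Step.exists_isMatch {ρ : Rule.{u} AP AT} (hρ : ρ.IsReplacement)
    {N M : PTNet.{u} AP AT} {o : ρ.L ⟶ N} (ho : IsInj o) (H : ρ.Step o M) :
    ∃ n : ρ.R ⟶ M, IsMatch n := by
  obtain ⟨D, k, g, n, h, h₁, h₂⟩ := H.exists_isGluing hρ
  have hkg : IsInj (k ≫ g) := by
    rw [← h₁.w ⟨⟩]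
    exact ⟨ho.1.comp ρ.l_strict.inj.1, fun x => hρ.isEmpty.elim x⟩
  have hk : IsInj k := ⟨Function.Injective.of_comp (f := Hom.fP g) hkg.1,
    Function.Injective.of_comp (f := Hom.fT g) hkg.2⟩
  exact ⟨n, h₂.isInj (s := ⟨⟩) hk, h₂.tl_eq ⟨⟩⟩

/-- A match at other transitions than the one replaced is still there after the replacement. -/
theorem Rule.Step.exists_isMatch_of_ne {ρ : Rule.{u} AP AT} (hρ : ρ.IsReplacement)
    {N M X : PTNet.{u} AP AT} {o : ρ.L ⟶ N} (H : ρ.Step o M) {c : X ⟶ N} (hc : IsMatch c)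
    (hne : ∀ x t, X.tl x ≠ ρ.L.tl t) : ∃ c' : X ⟶ M, IsMatch c' := by
  obtain ⟨D, k, g, n, h, h₁, h₂⟩ := H.exists_isGluing hρ
  -- A gluing keeps the label of the replaced transition, so by `hne` the match avoids it and
  -- factors through the context `D`, which persists in `M`.
  obtain ⟨c', rfl⟩ := exists_lift h₁.strict c
    (fun x => by
      obtain hx | ⟨s, y, hy⟩ := h₁.cover_P (Hom.fP c x)
      · exact hx
      · obtain ⟨z, rfl⟩ := hρ.surj y
        exact ⟨Hom.fP k z, (fP_congr (h₁.w s) z).symm.trans hy⟩)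
    (fun x => by
      obtain hx | ⟨s, y, hy⟩ := h₁.cover_T (Hom.fT c x)
      · exact hx
      · refine absurd ?_ (hne x y)
        rw [← hc.tl_eq, ← hy, h₁.tl_eq s])
  have hc' : IsMatch c' := ⟨⟨Function.Injective.of_comp (f := Hom.fP g) hc.inj.1,
    Function.Injective.of_comp (f := Hom.fT g) hc.inj.2⟩,
    fun t => (h₁.strict.tl_eq _).symm.trans (hc.tl_eq t)⟩
  exact ⟨c' ≫ h, hc'.comp h₂.strict.isMatch⟩

variable {ι : Type u} {ρ : ι → Rule.{u} AP AT}

theorem Derivation.exists_isMatch_of_notMem (hρ : ∀ p, (ρ p).IsReplacement)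
    (hl : ∀ p q t t', (ρ p).L.tl t = (ρ q).L.tl t' → p = q) {N F : PTNet.{u} AP AT} {l : List ι}
    (H : Derivation ρ N l F) {p : ι} (hp : p ∉ l) {c : (ρ p).L ⟶ N} (hc : IsMatch c) :
    ∃ c' : (ρ p).L ⟶ F, IsMatch c' := by
  induction H with
  | nil N => exact ⟨c, hc⟩
  | cons i o ho step rest ih =>
    rw [List.mem_cons, not_or] at hp
    obtain ⟨c', hc'⟩ := step.exists_isMatch_of_ne (hρ i) hc fun x t h => hp.1 (hl _ _ _ _ h)
    exact ih hp.2 hc'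

/-- Applying `ρ q` puts its right-hand side, and with it a match of `ρ p`, into the current net;
from there on the match persists. -/
theorem Derivation.exists_isMatch_of_mem (hρ : ∀ p, (ρ p).IsReplacement)
    (hl : ∀ p q t t', (ρ p).L.tl t = (ρ q).L.tl t' → p = q) {N F : PTNet.{u} AP AT} {l : List ι}
    (H : Derivation ρ N l F) {p q : ι} (hp : p ∉ l) (hq : q ∈ l) {c : (ρ p).L ⟶ (ρ q).R}
    (hc : IsMatch c) : ∃ c' : (ρ p).L ⟶ F, IsMatch c' := by
  induction H with
  | nil N => cases hq
  | cons i o ho step rest ih =>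
    rw [List.mem_cons, not_or] at hp
    obtain rfl | hq := List.mem_cons.1 hq
    · obtain ⟨n, hn⟩ := step.exists_isMatch (hρ q) ho
      exact rest.exists_isMatch_of_notMem hρ hl hp.2 (hc.comp hn)
    · exact ih hp.2 hq

/-- If every transition to be replaced belongs to the initial net or to the right-hand side of a
rule of smaller depth, then a maximal derivation uses every rule. -/
theorem TransformationUnit.mem_of_hierarchy (hρ : ∀ p, (ρ p).IsReplacement)
    (hl : ∀ p q t t', (ρ p).L.tl t = (ρ q).L.tl t' → p = q) {N F : PTNet.{u} AP AT} {l : List ι}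
    (depth : ι → ℕ)
    (hd : ∀ p, (∃ c : (ρ p).L ⟶ N, IsMatch c) ∨
      ∃ q, depth q < depth p ∧ ∃ c : (ρ p).L ⟶ (ρ q).R, IsMatch c)
    (H : TransformationUnit ρ N l F) (p : ι) : p ∈ l := by
  induction hn : depth p using Nat.strong_induction_on generalizing p with
  | _ n ih =>
    subst hn
    by_contra hp
    -- An unused rule would still match the final net, by induction even if its transition has to be
    -- inserted by another rule first.
    have hF : ∃ c : (ρ p).L ⟶ F, IsMatch c := by
      obtain ⟨c, hc⟩ | ⟨q, hq, c, hc⟩ := hd p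
      · exact H.1.exists_isMatch_of_notMem hρ hl hp hc
      · exact H.1.exists_isMatch_of_mem hρ hl hp (ih _ hq q rfl) hc
    obtain ⟨c, hc⟩ := hF
    obtain ⟨M, hM⟩ := hc.exists_step (hρ p)
    exact H.2 p c hc.inj M hM

end Matches

/-! ### The ambient net and the models inside it. -/

section Systems

variable {AP : Type v} {AT : Type w} [PartialOrder AP] [PartialOrder AT]

theorem mem_adj_map {M N : PTNet.{u} AP AT} {f : M ⟶ N} (hf : Function.Injective (Hom.fP f))
    (t : M.T) (x : M.P) : Hom.fP f x ∈ N.adj (Hom.fT f t) ↔ x ∈ M.adj t := by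
  simp only [adj, Set.mem_ofPred_eq, Hom.map_pre f, Hom.map_post f, Finsupp.mapDomain_apply hf]

variable {ι : Type u}

/-- An owner (`none` stands for the initial net) is active if it is the initial net or in `A`. -/
def Active (A : Set ι) (i : Option ι) : Prop := ∀ p, i = some p → p ∈ A

theorem active_none (A : Set ι) : Active A none := nofun

theorem active_some {A : Set ι} {p : ι} : Active A (some p) ↔ p ∈ A :=
  ⟨fun h => h p rfl, fun h q hq => by cases hq; exact h⟩

theorem Active.mono {A B : Set ι} (hAB : A ⊆ B) {i : Option ι} (h : Active A i) : Active B i :=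
  fun p hp => hAB (h p hp)

theorem active_union {A B : Set ι} {i : Option ι} (h : Active (A ∪ B) i) :
    Active A i ∨ ∃ p ∈ B, i = some p := by
  cases i with
  | none => exact Or.inl (active_none A)
  | some p => exact (active_some.1 h).imp active_some.2 fun h => ⟨p, h, rfl⟩

/-- A net `U` that contains the initial net `N` and the right-hand sides of all rules, glued
together along the interfaces, with all transitions that the rules replace still present.
`ownP` and `ownT` tell from which net a place or a transition comes. -/
structure System [OrderTop AT] (ρ : ι → Rule.{u} AP AT) (depth : ι → ℕ) (names : Set AT)
    (N : PTNet.{u} AP AT) where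
  U : PTNet.{u} AP AT
  base : N ⟶ U
  left : ∀ p, (ρ p).L ⟶ U
  right : ∀ p, (ρ p).R ⟶ U
  tr : ι → U.T
  ownP : U.P → Option ι
  ownT : U.T → Option ι
  base_strict : IsStrict base
  left_strict : ∀ p, IsStrict (left p)
  right_strict : ∀ p, IsStrict (right p)
  comm : ∀ p, (ρ p).l ≫ left p = (ρ p).r ≫ right p
  left_tr : ∀ p t, Hom.fT (left p) t = tr p
  base_P : ∀ x, (∃ y, Hom.fP base y = x) ↔ ownP x = none
  base_T : ∀ x, (∃ y, Hom.fT base y = x) ↔ ownT x = none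
  right_P : ∀ p x, (∃ y, Hom.fP (right p) y = x) ↔
    ownP x = some p ∨ ∃ z, Hom.fP (right p) (Hom.fP (ρ p).r z) = x
  right_T : ∀ p x, (∃ y, Hom.fT (right p) y = x) ↔ ownT x = some p
  own_adj : ∀ V : Option ι → Prop, (∀ p, V (some p) → V (ownT (tr p))) →
    ∀ x y, y ∈ U.adj x → V (ownT x) → V (ownP y)
  depth_tr : ∀ p, (ownT (tr p) = none ∧ depth p = 0) ∨
    ∃ q, ownT (tr p) = some q ∧ depth p = depth q + 1
  tl_mem : ∀ x, U.tl x ∈ names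
  tl_ne : ∀ p, U.tl (tr p) ≠ ⊤
  tl_eq : ∀ p x, U.tl x = U.tl (tr p) → x = tr p
  tr_inj : Function.Injective tr

namespace System

variable [OrderTop AT] {ρ : ι → Rule.{u} AP AT} {depth : ι → ℕ} {names : Set AT}
  {N : PTNet.{u} AP AT} (Y : System ρ depth names N)

/-- With a transition, the one that its net replaces has been replaced too. -/
def Closed (A : Set ι) : Prop := ∀ p ∈ A, Active A (Y.ownT (Y.tr p))

/-- The left-hand side of `ρ p` has only one injective occurrence at the transition `tr p`. -/
def Rigid (p : ι) : Prop :=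
  ∀ o : (ρ p).L ⟶ Y.U, IsInj o → (∀ t, Hom.fT o t = Y.tr p) → o = Y.left p

/-- `e` identifies `M` with the result of replacing the transitions in `A`. -/
structure Model (A : Set ι) {M : PTNet.{u} AP AT} (e : M ⟶ Y.U) : Prop where
  strict : IsStrict e
  range_P : ∀ x, (∃ m, Hom.fP e m = x) ↔ Active A (Y.ownP x)
  range_T : ∀ x, (∃ m, Hom.fT e m = x) ↔ Active A (Y.ownT x) ∧ ∀ p ∈ A, x ≠ Y.tr p

theorem model_base : Y.Model ∅ Y.base where
  strict := Y.base_strict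
  range_P x := by
    rw [Y.base_P]
    constructor
    · intro h
      rw [h]
      exact active_none _
    · intro h
      by_contra h'
      obtain ⟨p, hp⟩ := Option.ne_none_iff_exists'.1 h'
      exact h p hp
  range_T x := by
    rw [Y.base_T]
    constructor
    · intro h
      rw [h]
      exact ⟨active_none _, fun _ hp => hp.elim⟩
    · intro h
      by_contra h'
      obtain ⟨p, hp⟩ := Option.ne_none_iff_exists'.1 h'
      exact h.1 p hp

variable {Y}

/-- Strict morphisms with equal ranges factor through each other, and cancellation makes the two
factors mutually inverse. -/
theorem Model.nonempty_iso {A : Set ι} {M M' : PTNet.{u} AP AT} {e : M ⟶ Y.U} {e' : M' ⟶ Y.U}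
    (he : Y.Model A e) (he' : Y.Model A e') : Nonempty (M ≅ M') := by
  obtain ⟨f, hf⟩ := exists_lift he'.strict e
    (fun x => (he'.range_P _).2 ((he.range_P _).1 ⟨x, rfl⟩))
    fun x => (he'.range_T _).2 ((he.range_T _).1 ⟨x, rfl⟩)
  obtain ⟨f', hf'⟩ := exists_lift he.strict e'
    (fun x => (he.range_P _).2 ((he'.range_P _).1 ⟨x, rfl⟩))
    fun x => (he.range_T _).2 ((he'.range_T _).1 ⟨x, rfl⟩)
  exact ⟨⟨f, f', he.strict.cancel (by rw [Category.assoc, hf', hf, Category.id_comp]),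
    he'.strict.cancel (by rw [Category.assoc, hf, hf', Category.id_comp])⟩⟩

theorem Closed.union {A B : Set ι} (hA : Y.Closed A) (hB : ∀ p ∈ B, Active A (Y.ownT (Y.tr p))) :
    Y.Closed (A ∪ B) := by
  rintro p (hp | hp)
  exacts [(hA p hp).mono Set.subset_union_left, (hB p hp).mono Set.subset_union_left]

/-- Places adjacent to an active transition are active: they come from the same net or, through
interfaces, from one further up, and `A` is closed under going up. So the whole left-hand side lies
in the model. -/
theorem Model.exists_occurrence (hρ : ∀ p, (ρ p).IsReplacement) {A : Set ι} (hA : Y.Closed A)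
    {M : PTNet.{u} AP AT} {e : M ⟶ Y.U} (he : Y.Model A e) {p : ι}
    (hp : Active A (Y.ownT (Y.tr p))) (hpA : p ∉ A) {o : (ρ p).L ⟶ Y.U} (ho : IsInj o)
    (hot : ∀ t, Hom.fT o t = Y.tr p) : ∃ o' : (ρ p).L ⟶ M, o' ≫ e = o := by
  obtain ⟨t, -⟩ := (hρ p).single
  refine exists_lift he.strict o (fun x => (he.range_P _).2 ?_) fun x => (he.range_T _).2 ?_
  · refine Y.own_adj (Active A) (fun q hq => hA q (active_some.1 hq)) (Y.tr p) _ ?_ hp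
    rw [← hot t, mem_adj_map ho.1]
    exact (hρ p).adj t x
  · rw [hot]
    refine ⟨hp, fun q hq h => hpA ?_⟩
    rwa [Y.tr_inj h]

theorem left_inj (Y : System ρ depth names N) (p : ι) : IsInj (Y.left p) := (Y.left_strict p).inj

/-- An occurrence that is part of a gluing lies at the transition that is to be replaced. -/
theorem Model.map_occurrence {A : Set ι} {M : PTNet.{u} AP AT} {e : M ⟶ Y.U} (he : Y.Model A e)
    {p : ι} {o : (ρ p).L ⟶ M} (ho : ∀ t, M.tl (Hom.fT o t) = (ρ p).L.tl t) (t : (ρ p).L.T) :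
    Hom.fT (o ≫ e) t = Y.tr p := by
  -- Replaced transitions have unique labels in `U`. Morphisms may lower labels, but `ho` excludes
  -- this here.
  apply Y.tl_eq
  rw [← Y.left_tr p t, (Y.left_strict p).tl_eq, comp_fT, he.strict.tl_eq, ho]

/-- The embedding of the context `D` and the maps `Y.right` agree on the interfaces, so they induce
a morphism from `M'` to `U`. Ownership separates the pieces: the context has owners active in `A`,
the new elements are owned by the `q s`, which are distinct and not in `A`. This yields injectivity
and the range. -/
theorem Model.glue (hρ : ∀ p, (ρ p).IsReplacement) {A : Set ι} (hA : Y.Closed A)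
    {M M' D : PTNet.{u} AP AT} {e : M ⟶ Y.U} (he : Y.Model A e) {S : Type u} {q : S → ι}
    (hq : Function.Injective q) (hqa : ∀ s, Active A (Y.ownT (Y.tr (q s)))) (hqA : ∀ s, q s ∉ A)
    {o : ∀ s, (ρ (q s)).L ⟶ M} (ho : ∀ s, o s ≫ e = Y.left (q s)) {k : ∀ s, (ρ (q s)).K ⟶ D}
    {g : D ⟶ M} {n : ∀ s, (ρ (q s)).R ⟶ M'} {h : D ⟶ M'}
    (G : IsGluing (fun s => (ρ (q s)).l) k o g) (G' : IsGluing (fun s => (ρ (q s)).r) k n h) :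
    ∃ e' : M' ⟶ Y.U, Y.Model (A ∪ Set.range q) e' := by
  have hd : IsStrict (g ≫ e) := G.strict.comp he.strict
  have hkd : ∀ s, (ρ (q s)).r ≫ Y.right (q s) = k s ≫ g ≫ e := fun s => by
    rw [← Y.comm, ← ho, ← Category.assoc, G.w, Category.assoc]
  obtain ⟨x, hnx, hhx⟩ := G'.isWidePushout.desc (fun s => Y.right (q s)) (g ≫ e) hkd
  have hk : ∀ s, IsStrict (k s) := fun s => hd.of_comp (by
    rw [← hkd]
    exact (ρ (q s)).r_strict.comp (Y.right_strict _))
  have hn : ∀ s, IsStrict (n s) := fun s => G'.isStrict (ρ (q s)).r_strict (hk s)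
  have hxh : ∀ y, Hom.fP x (Hom.fP h y) = Hom.fP e (Hom.fP g y) := fP_congr hhx
  have hxn : ∀ s y, Hom.fP x (Hom.fP (n s) y) = Hom.fP (Y.right (q s)) y :=
    fun s => fP_congr (hnx s)
  have hxh' : ∀ y, Hom.fT x (Hom.fT h y) = Hom.fT e (Hom.fT g y) := fT_congr hhx
  have hxn' : ∀ s y, Hom.fT x (Hom.fT (n s) y) = Hom.fT (Y.right (q s)) y :=
    fun s => fT_congr (hnx s)
  have hD : ∀ u, (∃ y, Hom.fP e (Hom.fP g y) = u) ↔ Active A (Y.ownP u) := by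
    intro u
    rw [← he.range_P]
    refine ⟨fun ⟨y, hy⟩ => ⟨_, hy⟩, ?_⟩
    rintro ⟨m, rfl⟩
    obtain ⟨y, rfl⟩ | ⟨s, y, rfl⟩ := G.cover_P m
    · exact ⟨y, rfl⟩
    · obtain ⟨z, rfl⟩ := (hρ (q s)).surj y
      exact ⟨Hom.fP (k s) z, congrArg _ (fP_congr (G.w s) z).symm⟩
  -- Interface places are counted with the context, so that in the second case the owner is known.
  have hcov : ∀ m, (∃ y, Hom.fP h y = m) ∨
      ∃ s y, Hom.fP (n s) y = m ∧ Y.ownP (Hom.fP x m) = some (q s) := by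
    intro m
    obtain hm | ⟨s, y, rfl⟩ := G'.cover_P m
    · exact Or.inl hm
    obtain hy | ⟨z, hz⟩ := (Y.right_P (q s) _).1 ⟨y, (hxn s y).symm⟩
    · exact Or.inr ⟨s, y, rfl, hy⟩
    · rw [hxn] at hz
      rw [← (Y.right_strict _).inj.1 hz]
      exact Or.inl ⟨_, (fP_congr (G'.w s) z).symm⟩
  have hown : ∀ s t, Y.ownT (Hom.fT (Y.right (q s)) t) = some (q s) :=
    fun s t => (Y.right_T _ _).1 ⟨t, rfl⟩
  have hgA : ∀ y, Active A (Y.ownT (Hom.fT e (Hom.fT g y))) :=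
    fun y => ((he.range_T _).1 ⟨_, rfl⟩).1
  refine ⟨x, ⟨⟨?_, ?_⟩, ?_, ?_, ?_⟩, ?_, ?_⟩
  · intro m m' hm
    obtain ⟨y, rfl⟩ | ⟨s, y, rfl, hy⟩ := hcov m <;>
      obtain ⟨y', rfl⟩ | ⟨s', y', rfl, hy'⟩ := hcov m'
    · rw [hxh, hxh] at hm
      rw [hd.inj.1 hm]
    · rw [← hm, hxh] at hy'
      exact absurd ((hD _).1 ⟨y, rfl⟩ _ hy') (hqA s')
    · rw [hm, hxh] at hy
      exact absurd ((hD _).1 ⟨y', rfl⟩ _ hy) (hqA s)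
    · rw [hm, hy'] at hy
      obtain rfl := hq (Option.some_injective _ hy)
      rw [hxn, hxn] at hm
      rw [(Y.right_strict _).inj.1 hm]
  · intro m m' hm
    obtain ⟨y, rfl⟩ | ⟨s, y, rfl⟩ := G'.cover_T m <;>
      obtain ⟨y', rfl⟩ | ⟨s', y', rfl⟩ := G'.cover_T m'
    · rw [hxh', hxh'] at hm
      rw [hd.inj.2 hm]
    · rw [hxh', hxn'] at hm
      exact absurd (hgA y _ (hm ▸ hown s' y')) (hqA s')
    · rw [hxh', hxn'] at hm
      exact absurd (hgA y' _ (hm ▸ hown s y)) (hqA s)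
    · rw [hxn', hxn'] at hm
      have h1 := hown s y
      rw [hm, hown] at h1
      obtain rfl := hq (Option.some_injective _ h1)
      rw [(Y.right_strict _).inj.2 hm]
  · intro m
    obtain ⟨y, rfl⟩ | ⟨s, y, rfl⟩ := G'.cover_P m
    · rw [hxh, G'.strict.pl_eq, ← hd.pl_eq, comp_fP]
    · rw [hxn, (hn s).pl_eq, (Y.right_strict _).pl_eq]
  · intro m
    obtain ⟨y, rfl⟩ | ⟨s, y, rfl⟩ := G'.cover_T m
    · rw [hxh', G'.strict.tl_eq, ← hd.tl_eq, comp_fT]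
    · rw [hxn', (hn s).tl_eq, (Y.right_strict _).tl_eq]
  · intro m
    obtain ⟨y, rfl⟩ | ⟨s, y, rfl⟩ := G'.cover_P m
    · rw [hxh, ← G'.strict.mrk_eq, hd.mrk_eq, comp_fP]
    · rw [hxn, ← (hn s).mrk_eq, (Y.right_strict _).mrk_eq]
  · intro u
    constructor
    · rintro ⟨m, rfl⟩
      obtain ⟨y, rfl⟩ | ⟨s, y, rfl, hy⟩ := hcov m
      · rw [hxh]
        exact ((hD _).1 ⟨y, rfl⟩).mono Set.subset_union_left
      · rw [hy, active_some]
        exact Or.inr ⟨s, rfl⟩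
    · intro hu
      obtain hu | ⟨_, ⟨s, rfl⟩, hu⟩ := active_union hu
      · obtain ⟨y, rfl⟩ := (hD u).2 hu
        exact ⟨_, hxh y⟩
      · obtain ⟨y, rfl⟩ := (Y.right_P _ _).2 (Or.inl hu)
        exact ⟨_, hxn s y⟩
  · intro u
    constructor
    · rintro ⟨m, rfl⟩
      obtain ⟨y, rfl⟩ | ⟨s, y, rfl⟩ := G'.cover_T m
      · rw [hxh']
        refine ⟨(hgA y).mono Set.subset_union_left, ?_⟩
        rintro _ (hp | ⟨s, rfl⟩) hyp
        · exact ((he.range_T _).1 ⟨_, rfl⟩).2 _ hp hyp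
        · obtain ⟨t, -⟩ := (hρ (q s)).single
          rw [← Y.left_tr _ t, ← ho] at hyp
          exact G.inter_T s t y (he.strict.inj.2 hyp.symm)
      · rw [hxn']
        refine ⟨?_, ?_⟩
        · rw [hown, active_some]
          exact Or.inr ⟨s, rfl⟩
        -- If this transition were one of those replaced, `hA` or `hqa` would make its owner `q s`
        -- active, against `hqA`.
        · have h1 := hown s y
          rintro _ (hp | ⟨s', rfl⟩) hyp <;> rw [hyp] at h1
          · exact hqA s (hA _ hp _ h1)
          · exact hqA s (hqa s' _ h1)
    · rintro ⟨hu, hu'⟩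
      obtain hu | ⟨_, ⟨s, rfl⟩, hu⟩ := active_union hu
      · obtain ⟨m, rfl⟩ := (he.range_T u).2 ⟨hu, fun p hp => hu' p (Or.inl hp)⟩
        obtain ⟨y, rfl⟩ | ⟨s, y, rfl⟩ := G.cover_T m
        · exact ⟨_, hxh' y⟩
        · refine absurd ?_ (hu' (q s) (Or.inr ⟨s, rfl⟩))
          rw [← Y.left_tr _ y, ← ho, comp_fT]
      · obtain ⟨y, rfl⟩ := (Y.right_T _ _).2 hu
        exact ⟨_, hxn' s y⟩

/-- The pushout forces the exact label, hence the transition `tr p`, and rigidity then forces the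
occurrence `Y.left p`. As a model of `A` lacks the transitions replaced by `A`, the rule is new. -/
theorem Model.step (hρ : ∀ p, (ρ p).IsReplacement) {A : Set ι} (hA : Y.Closed A)
    {M M' : PTNet.{u} AP AT} {e : M ⟶ Y.U} (he : Y.Model A e) {p : ι} (hp : Y.Rigid p)
    {o : (ρ p).L ⟶ M} (ho : IsInj o) (H : (ρ p).Step o M') :
    p ∉ A ∧ Active A (Y.ownT (Y.tr p)) ∧ ∃ e' : M' ⟶ Y.U, Y.Model (A ∪ {p}) e' := by
  obtain ⟨D, k, g, n, h, G, G'⟩ := H.exists_isGluing (hρ p)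
  have hot := he.map_occurrence (G.tl_eq ⟨⟩)
  have hoe : o ≫ e = Y.left p :=
    hp _ ⟨he.strict.inj.1.comp ho.1, he.strict.inj.2.comp ho.2⟩ hot
  obtain ⟨t, -⟩ := (hρ p).single
  obtain ⟨ha, hne⟩ := (he.range_T (Y.tr p)).1 ⟨_, hot t⟩
  have hpA : p ∉ A := fun hpA => hne p hpA rfl
  refine ⟨hpA, ha, ?_⟩
  have hpc : Set.range (fun _ : PUnit.{u + 1} => p) = {p} := Set.range_const
  rw [← hpc]
  exact he.glue hρ hA (q := fun _ : PUnit.{u + 1} => p) (fun _ _ _ => rfl) (fun _ => ha)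
    (fun _ => hpA) (fun _ => hoe) G G'

theorem Model.derivation (hρ : ∀ p, (ρ p).IsReplacement) {A : Set ι} (hA : Y.Closed A)
    {M F : PTNet.{u} AP AT} {e : M ⟶ Y.U} (he : Y.Model A e) {l : List ι}
    (hl : ∀ p ∈ l, Y.Rigid p) (H : Derivation ρ M l F) :
    l.Nodup ∧ (∀ p ∈ l, p ∉ A) ∧ ∃ e' : F ⟶ Y.U, Y.Model (A ∪ {p | p ∈ l}) e' := by
  induction H generalizing A with
  | nil N => exact ⟨List.nodup_nil, nofun, e, by simpa using he⟩
  | @cons N M' F l i o ho step rest ih =>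
    obtain ⟨hi, ha, e', he'⟩ := he.step hρ hA (hl i List.mem_cons_self) ho step
    obtain ⟨h1, h2, e'', h3⟩ := ih (hA.union fun p hp => by cases hp; exact ha) he'
      fun p hp => hl p (List.mem_cons_of_mem i hp)
    refine ⟨List.nodup_cons.2 ⟨fun h => h2 i h (Or.inr rfl), h1⟩, ?_, e'', ?_⟩
    · rintro p hp hpA
      obtain rfl | hp := List.mem_cons.1 hp
      exacts [hi hpA, h2 p hp (Or.inl hpA)]
    · have hs : A ∪ {p | p ∈ i :: l} = A ∪ {i} ∪ {p | p ∈ l} := by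
        ext p
        simp [or_assoc, or_left_comm]
      rwa [hs]

/-- The existence of the pushout is itself information: the copies of left-hand sides stay disjoint
on transitions, so two occurrences at one transition are the same element of `S`. This gives
rigidity, one substitution per rule, and finiteness of `S`, after which `Model.glue` applies. -/
theorem Model.parallel [Finite ι] (hρ : ∀ p, (ρ p).IsReplacement) {A : Set ι} (hA : Y.Closed A)
    {M M' : PTNet.{u} AP AT} {e : M ⟶ Y.U} (he : Y.Model A e) {κ : Type u} {f : κ → ι}
    (hf : Function.Injective f) (hfa : ∀ i, Active A (Y.ownT (Y.tr (f i)))) (hfA : ∀ i, f i ∉ A)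
    (H : ParallelTransformation (fun i => ρ (f i)) M M') :
    (∃ e' : M' ⟶ Y.U, Y.Model (A ∪ Set.range f) e') ∧ (∀ i, Y.Rigid (f i)) ∧
      ∀ i, ∃! s : Substitution (fun i => ρ (f i)) M, s.idx = i := by
  obtain ⟨L, K, R, l, r, o, ⟨hL⟩, ⟨hK⟩, ⟨hR⟩, hl, hr, ho, D, k, g, n, h, h₁, h₂⟩ := H
  have W := isWidePushout_of_coproduct (r := fun s : Substitution (fun i => ρ (f i)) M =>
    (ρ (f s.idx)).l) K L hK hL hl h₁
  have W' := isWidePushout_of_coproduct (r := fun s : Substitution (fun i => ρ (f i)) M =>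
    (ρ (f s.idx)).r) K R hK hR hr h₂
  have ho' : (fun s => L.inj s ≫ o) = fun s => s.occ := funext ho
  rw [ho'] at W
  -- `S` is not known to be finite yet, but the left legs add no places and hence no tokens.
  have G := W.isGluing (fun s => (ρ (f s.idx)).l_strict) (fun s => (hρ _).isEmpty)
    (finiteTokens_of_surjective fun s => (hρ _).surj)
  have hot : ∀ (s : Substitution (fun i => ρ (f i)) M) t,
      Hom.fT (s.occ ≫ e) t = Y.tr (f s.idx) := fun s => he.map_occurrence (G.tl_eq s)
  have hrig : ∀ i, Y.Rigid (f i) := by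
    intro i a ha hat
    obtain ⟨a', rfl⟩ := he.exists_occurrence hρ hA (hfa i) (hfA i) ha hat
    obtain ⟨c, hc⟩ := he.exists_occurrence hρ hA (hfa i) (hfA i) (Y.left_inj (f i))
      (Y.left_tr (f i))
    have inj_of_comp : ∀ {b : (ρ (f i)).L ⟶ M}, IsInj (b ≫ e) → IsInj b := fun hb =>
      ⟨Function.Injective.of_comp (f := Hom.fP e) hb.1,
        Function.Injective.of_comp (f := Hom.fT e) hb.2⟩
    obtain ⟨t, -⟩ := (hρ (f i)).single
    let s₁ : Substitution (fun i => ρ (f i)) M := ⟨i, a', inj_of_comp ha⟩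
    let s₂ : Substitution (fun i => ρ (f i)) M := ⟨i, c, inj_of_comp (hc ▸ Y.left_inj (f i))⟩
    -- Both occurrences send `t` to the same transition, which a gluing permits only for equal
    -- indices.
    have h1 := G.inj_T s₁ t s₂ t (he.strict.inj.2 ((hot s₁ t).trans (hot s₂ t).symm))
    have h2 := congrArg Sigma.fst h1
    cases h2
    exact hc
  have hoc : ∀ s : Substitution (fun i => ρ (f i)) M, s.occ ≫ e = Y.left (f s.idx) := fun s =>
    hrig _ _ ⟨he.strict.inj.1.comp s.inj.1, he.strict.inj.2.comp s.inj.2⟩ (hot s)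
  have hinj : ∀ s s' : Substitution (fun i => ρ (f i)) M, s.idx = s'.idx → s = s' := by
    rintro ⟨i, a, ha⟩ ⟨j, b, hb⟩ (rfl : i = j)
    have hab : a = b := he.strict.cancel ((hoc ⟨i, a, ha⟩).trans (hoc ⟨i, b, hb⟩).symm)
    subst hab
    rfl
  have hsurj : ∀ i, ∃ s : Substitution (fun i => ρ (f i)) M, s.idx = i := by
    intro i
    obtain ⟨c, hc⟩ := he.exists_occurrence hρ hA (hfa i) (hfA i) (Y.left_inj (f i))
      (Y.left_tr (f i))
    have hi := Y.left_inj (f i)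
    rw [← hc] at hi
    exact ⟨⟨i, c, Function.Injective.of_comp (f := Hom.fP e) hi.1,
      Function.Injective.of_comp (f := Hom.fT e) hi.2⟩, rfl⟩
  have hq : Function.Injective fun s : Substitution (fun i => ρ (f i)) M => f s.idx :=
    fun s s' hs => hinj s s' (hf hs)
  -- Only now can the right legs, which may add tokens, be treated.
  have : Finite (Substitution (fun i => ρ (f i)) M) := Finite.of_injective _ hq
  have G' := W'.isGluing (fun s => (ρ (f s.idx)).r_strict) (fun s => (hρ _).isEmpty)
    (finiteTokens_of_finite _)
  refine ⟨?_, hrig, fun i => ?_⟩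
  · have hrange : Set.range f =
        Set.range fun s : Substitution (fun i => ρ (f i)) M => f s.idx := by
      ext p
      constructor
      · rintro ⟨i, rfl⟩
        obtain ⟨s, rfl⟩ := hsurj i
        exact ⟨s, rfl⟩
      · rintro ⟨s, rfl⟩
        exact ⟨s.idx, rfl⟩
    rw [hrange]
    exact he.glue hρ hA hq (fun s => hfa _) (fun s => hfA _) hoc G G'
  · obtain ⟨s, hs⟩ := hsurj i
    exact ⟨s, hs, fun s' hs' => hinj s' s (hs'.trans hs.symm)⟩

end System

end Systems

/-! ### Recursive construction of the ambient net. -/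

section Construction

variable {AP : Type v} {AT : Type w} [PartialOrder AP] [PartialOrder AT]

theorem exists_of_mem_adj_map {M N : PTNet.{u} AP AT} {f : M ⟶ N}
    (hf : Function.Injective (Hom.fP f)) {t : M.T} {y : N.P} (hy : y ∈ N.adj (Hom.fT f t)) :
    ∃ x ∈ M.adj t, Hom.fP f x = y := by
  have hr : y ∈ Set.range (Hom.fP f) := by
    by_contra h
    simp only [adj, Set.mem_ofPred_eq, Hom.map_pre f, Hom.map_post f,
      Finsupp.mapDomain_of_notMem_range _ _ h] at hy
    simp at hy
  obtain ⟨x, rfl⟩ := hr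
  exact ⟨x, (mem_adj_map hf t x).1 hy, rfl⟩

theorem mapDomain_subtypeDomain {α : Type*} {p : α → Prop} (f : α →₀ ℕ)
    (hf : ∀ x, f x ≠ 0 → p x) : Finsupp.mapDomain Subtype.val (f.subtypeDomain p) = f := by
  ext x
  by_cases hx : p x
  · exact Finsupp.mapDomain_apply Subtype.val_injective _ (⟨x, hx⟩ : Subtype p)
  · rw [Finsupp.mapDomain_of_notMem_range _ _ (by simpa using hx)]
    exact (not_not.1 fun h => hx (hf x h)).symm

/-- The inclusion `Net(t) ⟶ N`. -/
noncomputable def netIncl (N : PTNet.{u} AP AT) (t : N.T) : N.netOf t ⟶ N :=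
  ({ fP := Subtype.val
     fT := fun _ => t
     map_pre := fun _ => (mapDomain_subtypeDomain _ fun _ => Or.inl).symm
     map_post := fun _ => (mapDomain_subtypeDomain _ fun _ => Or.inr).symm
     map_mrk := fun _ => le_rfl
     map_pl := fun _ => le_rfl
     map_tl := fun _ => le_rfl } : Hom (N.netOf t) N)

theorem netIncl_isStrict (N : PTNet.{u} AP AT) (t : N.T) : IsStrict (N.netIncl t) :=
  ⟨⟨Subtype.val_injective, fun _ _ _ => rfl⟩, fun _ => rfl, fun _ => rfl, fun _ => rfl⟩

/-- The inclusion `CP(t) ⟶ N`. -/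
noncomputable def connInclNet (N : PTNet.{u} AP AT) (t : N.T) : N.connOf t ⟶ N :=
  N.connIncl t ≫ N.netIncl t

theorem connInclNet_isStrict (N : PTNet.{u} AP AT) (t : N.T) : IsStrict (N.connInclNet t) :=
  (N.connIncl_isStrict t).comp (N.netIncl_isStrict t)

/-- The rule `Net(t) ⟵ CP(t) ⟶ R`. -/
noncomputable def replaceRule (N : PTNet.{u} AP AT) (t : N.T) {R : PTNet.{u} AP AT}
    (r : N.connOf t ⟶ R) (hr : IsStrict r) : Rule.{u} AP AT where
  L := N.netOf t
  K := N.connOf t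
  R := R
  l := N.connIncl t
  r := r
  l_strict := N.connIncl_isStrict t
  r_strict := hr

theorem replaceRule_isReplacement (N : PTNet.{u} AP AT) (t : N.T) {R : PTNet.{u} AP AT}
    (r : N.connOf t ⟶ R) (hr : IsStrict r) : (replaceRule N t r hr).IsReplacement where
  isEmpty := inferInstanceAs (IsEmpty PEmpty)
  surj x := ⟨x, rfl⟩
  single := ⟨PUnit.unit, fun _ => rfl⟩
  adj _ x := x.2

variable {N : PTNet.{u} AP AT} {S : Type u} {ι : S → Type u}

/-- The rules of a hierarchy: those of the top level and those of the levels below. -/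
def consRule (top : S → Rule.{u} AP AT) (ρ : ∀ s, ι s → Rule.{u} AP AT) :
    (Σ s, Option (ι s)) → Rule.{u} AP AT
  | ⟨s, none⟩ => top s
  | ⟨s, some p⟩ => ρ s p

/-- The depths of the rules of a hierarchy. -/
def consDepth (d : ∀ s, ι s → ℕ) : (Σ s, Option (ι s)) → ℕ
  | ⟨_, none⟩ => 0
  | ⟨s, some p⟩ => d s p + 1

/-- The transitions that the rules of a hierarchy replace. -/
def consTr {U : PTNet.{u} AP AT} {V : S → PTNet.{u} AP AT} (a : S → U.T)
    (b : ∀ s, (V s).T → U.T) (tr : ∀ s, ι s → (V s).T) : (Σ s, Option (ι s)) → U.T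
  | ⟨s, none⟩ => a s
  | ⟨s, some p⟩ => b s (tr s p)

/-- If systems for the subnets of all substitution transitions are given, then gluing them to the
net gives a system for the whole hierarchy. -/
theorem System.nonempty_cons [OrderTop AT] (lay : Layer N) [Finite lay.sT]
    {SN : lay.sT → PTNet.{u} AP AT} {emb : ∀ t : lay.sT, N.connOf t.1 ⟶ SN t}
    (emb_strict : ∀ t, IsStrict (emb t)) {ι : lay.sT → Type u} {ρ : ∀ t, ι t → Rule.{u} AP AT}
    {d : ∀ t, ι t → ℕ} {names : lay.sT → Set AT} (Y : ∀ t, System (ρ t) (d t) (names t) (SN t))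
    (htop : ∀ t ∈ lay.sT, N.tl t ≠ ⊤) (hN : ∀ t, lay.nameT ∩ names t ⊆ {⊤})
    (hne : ∀ t t', t ≠ t' → names t ∩ names t' ⊆ {⊤}) :
    Nonempty (System (consRule (fun t => replaceRule N t.1 (emb t) (emb_strict t)) ρ)
      (consDepth d) (lay.nameT ∪ ⋃ t, names t) N) := by
  have hr : ∀ t : lay.sT, IsStrict (emb t ≫ (Y t).base) :=
    fun t => (emb_strict t).comp (Y t).base_strict
  have hk : ∀ t : lay.sT, IsStrict (N.connInclNet t.1) := fun t => N.connInclNet_isStrict t.1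
  have hK : ∀ t : lay.sT, IsEmpty (N.connOf t.1).T := fun t => inferInstanceAs (IsEmpty PEmpty)
  have hf := finiteTokens_of_finite fun t : lay.sT => emb t ≫ (Y t).base
  have G := isGluing_glue hr (fun t => N.connInclNet t.1) hK hf
  let U := glue (fun t : lay.sT => N.connInclNet t.1) hf
  let h : N ⟶ U := glueBase (fun t : lay.sT => N.connInclNet t.1) hf
  let n : ∀ t, (Y t).U ⟶ U := gluePart hr (fun t : lay.sT => N.connInclNet t.1) hf
  have hn : ∀ t, IsStrict (n t) := fun t => G.isStrict (hr t) (hk t)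
  have hh : IsStrict h := G.strict
  have hw : ∀ t, emb t ≫ (Y t).base ≫ n t = N.connInclNet t.1 ≫ h := fun t => by
    rw [← Category.assoc]
    exact G.w t
  have glue_ne : ∀ t x (hx : ∀ z, Hom.fP (emb t ≫ (Y t).base) z ≠ x),
      Hom.fP (n t) x = Sum.inr ⟨t, x, hx⟩ := fun t x hx =>
    gluePlace_of_ne (r := fun t : lay.sT => emb t ≫ (Y t).base) (fun t => N.connInclNet t.1) hx
  -- Owners shift by one level: what is initial in the system of `SN t` is inserted by the rule `⟨t,
  -- none⟩`. Connecting places are identified with places of `N` and so count as initial.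
  let ownP : U.P → Option (Σ t, Option (ι t)) :=
    Sum.elim (fun _ => none) fun q => some ⟨q.1, (Y q.1).ownP q.2.1⟩
  let ownT : U.T → Option (Σ t, Option (ι t)) :=
    Sum.elim (fun _ => none) fun q => some ⟨q.1, (Y q.1).ownT q.2⟩
  have own_base : ∀ t y, (Y t).ownP (Hom.fP (Y t).base y) = none :=
    fun t y => ((Y t).base_P _).1 ⟨y, rfl⟩
  have own_n : ∀ t x, (∃ z, Hom.fP (Y t).base (Hom.fP (emb t) z) = x) ∨
      ownP (Hom.fP (n t) x) = some ⟨t, (Y t).ownP x⟩ := by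
    intro t x
    by_cases hx : ∃ z, Hom.fP (Y t).base (Hom.fP (emb t) z) = x
    · exact Or.inl hx
    · right
      rw [glue_ne t x (not_exists.1 hx)]
      rfl
  have own_inv : ∀ y t i, ownP y = some ⟨t, i⟩ →
      ∃ x, Hom.fP (n t) x = y ∧ (Y t).ownP x = i := by
    rintro (y | ⟨t', x, hx⟩) t i hy
    · cases hy
    · have hy' : some (⟨t', (Y t').ownP x⟩ : Σ t, Option (ι t)) = some ⟨t, i⟩ := hy
      cases hy'
      exact ⟨x, glue_ne _ x hx, rfl⟩
  let tr : (Σ t, Option (ι t)) → U.T :=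
    consTr (fun t => Hom.fT h t.1) (fun t => Hom.fT (n t)) fun t => (Y t).tr
  refine ⟨{
    U := U
    base := h
    left := fun q => match q with
      | ⟨t, none⟩ => N.netIncl t.1 ≫ h
      | ⟨t, some p⟩ => (Y t).left p ≫ n t
    right := fun q => match q with
      | ⟨t, none⟩ => (Y t).base ≫ n t
      | ⟨t, some p⟩ => (Y t).right p ≫ n t
    tr := tr
    ownP := ownP
    ownT := ownT
    base_strict := hh
    left_strict := ?_
    right_strict := ?_
    comm := ?_
    left_tr := ?_
    base_P := ?_
    base_T := ?_
    right_P := ?_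
    right_T := ?_
    own_adj := ?_
    depth_tr := ?_
    tl_mem := ?_
    tl_ne := ?_
    tl_eq := ?_
    tr_inj := ?_ }⟩
  · rintro ⟨t, _ | p⟩
    exacts [(N.netIncl_isStrict t.1).comp hh, ((Y t).left_strict p).comp (hn t)]
  · rintro ⟨t, _ | p⟩
    exacts [(Y t).base_strict.comp (hn t), ((Y t).right_strict p).comp (hn t)]
  · rintro ⟨t, _ | p⟩
    · exact (hw t).symm
    · change (ρ t p).l ≫ (Y t).left p ≫ n t = (ρ t p).r ≫ (Y t).right p ≫ n t
      rw [← Category.assoc, (Y t).comm, Category.assoc]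
  · rintro ⟨t, _ | p⟩ x
    · rfl
    · exact congrArg (Hom.fT (n t)) ((Y t).left_tr p x)
  · rintro (x | ⟨t, x⟩)
    · exact ⟨fun _ => rfl, fun _ => ⟨x, rfl⟩⟩
    · exact ⟨fun ⟨y, hy⟩ => (nomatch hy), nofun⟩
  · rintro (x | ⟨t, x⟩)
    · exact ⟨fun _ => rfl, fun _ => ⟨x, rfl⟩⟩
    · exact ⟨fun ⟨y, hy⟩ => (nomatch hy), nofun⟩
  · rintro ⟨t, _ | p⟩ x
    · change (∃ y, Hom.fP (n t) (Hom.fP (Y t).base y) = x) ↔ ownP x = some ⟨t, none⟩ ∨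
        ∃ z, Hom.fP (n t) (Hom.fP (Y t).base (Hom.fP (emb t) z)) = x
      constructor
      · rintro ⟨y, rfl⟩
        obtain ⟨z, hz⟩ | hy := own_n t (Hom.fP (Y t).base y)
        · exact Or.inr ⟨z, by rw [hz]⟩
        · rw [own_base] at hy
          exact Or.inl hy
      · rintro (hx | ⟨z, hz⟩)
        · obtain ⟨x', rfl, hx'⟩ := own_inv _ _ _ hx
          obtain ⟨y, rfl⟩ := ((Y t).base_P x').2 hx'
          exact ⟨y, rfl⟩
        · exact ⟨_, hz⟩
    · change (∃ y, Hom.fP (n t) (Hom.fP ((Y t).right p) y) = x) ↔ ownP x = some ⟨t, some p⟩ ∨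
        ∃ z, Hom.fP (n t) (Hom.fP ((Y t).right p) (Hom.fP (ρ t p).r z)) = x
      constructor
      · rintro ⟨y, rfl⟩
        obtain hy | ⟨z, hz⟩ := ((Y t).right_P p _).1 ⟨y, rfl⟩
        · obtain ⟨z, hz⟩ | hy' := own_n t (Hom.fP ((Y t).right p) y)
          · rw [← hz, own_base] at hy
            cases hy
          · rw [hy] at hy'
            exact Or.inl hy'
        · exact Or.inr ⟨z, by rw [hz]⟩
      · rintro (hx | ⟨z, hz⟩)
        · obtain ⟨x', rfl, hx'⟩ := own_inv _ _ _ hx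
          obtain ⟨y, rfl⟩ := ((Y t).right_P p x').2 (Or.inl hx')
          exact ⟨y, rfl⟩
        · exact ⟨_, hz⟩
  · have own_inv' : ∀ y t i, ownT y = some ⟨t, i⟩ →
        ∃ x, Hom.fT (n t) x = y ∧ (Y t).ownT x = i := by
      rintro (y | ⟨t', x⟩) t i hy
      · cases hy
      · have hy' : some (⟨t', (Y t').ownT x⟩ : Σ t, Option (ι t)) = some ⟨t, i⟩ := hy
        cases hy'
        exact ⟨x, rfl, rfl⟩
    have own_n' : ∀ t x, ownT (Hom.fT (n t) x) = some ⟨t, (Y t).ownT x⟩ := fun _ _ => rfl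
    rintro ⟨t, _ | p⟩ x
    · constructor
      · rintro ⟨y, rfl⟩
        refine (own_n' t (Hom.fT (Y t).base y)).trans ?_
        rw [((Y t).base_T _).1 ⟨y, rfl⟩]
      · intro hx
        obtain ⟨x', rfl, hx'⟩ := own_inv' _ _ _ hx
        obtain ⟨y, rfl⟩ := ((Y t).base_T x').2 hx'
        exact ⟨y, rfl⟩
    · constructor
      · rintro ⟨y, rfl⟩
        refine (own_n' t (Hom.fT ((Y t).right p) y)).trans ?_
        rw [((Y t).right_T p _).1 ⟨y, rfl⟩]
      · intro hx
        obtain ⟨x', rfl, hx'⟩ := own_inv' _ _ _ hx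
        obtain ⟨y, rfl⟩ := ((Y t).right_T p x').2 hx'
        exact ⟨y, rfl⟩
  · rintro V hV (x | ⟨t, x⟩) y hy hx
    · obtain ⟨y', -, rfl⟩ := exists_of_mem_adj_map (f := h) hh.inj.1 hy
      exact hx
    · obtain ⟨y', hy', rfl⟩ := exists_of_mem_adj_map (f := n t) (hn t).inj.1 hy
      -- The recursion works because `own_adj` allows any predicate closed under going up: `V` is
      -- pulled back to the owners below `t`.
      have h1 : V (some ⟨t, (Y t).ownP y'⟩) := (Y t).own_adj (fun i => V (some ⟨t, i⟩))
        (fun p hp => hV ⟨t, some p⟩ hp) x y' hy' hx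
      obtain ⟨z, rfl⟩ | h2 := own_n t y'
      · rw [own_base] at h1
        have h3 : Hom.fP (n t) (Hom.fP (Y t).base (Hom.fP (emb t) z)) =
            Hom.fP h (Hom.fP (N.connInclNet t.1) z) := fP_congr (hw t) z
        rw [h3]
        -- A connecting place belongs to `N`, one level above the subnet; closure of `V` at the rule
        -- of `t` bridges the two.
        exact hV ⟨t, none⟩ h1
      · rw [h2]
        exact h1
  · rintro ⟨t, _ | p⟩
    · exact Or.inl ⟨rfl, rfl⟩
    · have h1 : ownT (tr ⟨t, some p⟩) = some ⟨t, (Y t).ownT ((Y t).tr p)⟩ := rfl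
      right
      obtain ⟨h2, h3⟩ | ⟨q, h2, h3⟩ := (Y t).depth_tr p
      · exact ⟨⟨t, none⟩, by rw [h1, h2], by simp [consDepth, h3]⟩
      · exact ⟨⟨t, some q⟩, by rw [h1, h2], by simp [consDepth, h3]⟩
  · rintro (x | ⟨t, x⟩)
    · exact Or.inl (lay.net_over.2 x)
    · exact Or.inr (Set.mem_iUnion.2 ⟨t, (Y t).tl_mem x⟩)
  · rintro ⟨t, _ | p⟩
    exacts [htop t.1 t.2, (Y t).tl_ne p]
  -- Within `N`, names of substitution transitions are reserved and distinct; across different nets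
  -- a common label would have to be `⊤`.
  · rintro ⟨t, _ | p⟩ (x | ⟨t', x⟩) hx
    · have hx' : N.tl x = N.tl t.1 := hx
      have hxs : x ∈ lay.sT := by
        by_contra hxs
        exact lay.tl_notMem x hxs (hx' ▸ lay.tl_mem t.1 t.2)
      exact congrArg Sum.inl (lay.tl_injOn hxs t.2 hx')
    · have hx' : (Y t').U.tl x = N.tl t.1 := hx
      exact absurd (hN t' ⟨lay.net_over.2 t.1, hx' ▸ (Y t').tl_mem x⟩) (htop t.1 t.2)
    · have hx' : N.tl x = (Y t).U.tl ((Y t).tr p) := hx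
      exact absurd (hN t ⟨hx' ▸ lay.net_over.2 x, (Y t).tl_mem _⟩) ((Y t).tl_ne p)
    · have hx' : (Y t').U.tl x = (Y t).U.tl ((Y t).tr p) := hx
      by_cases htt : t' = t
      · subst htt
        rw [(Y t').tl_eq p x hx']
        rfl
      · exact absurd (hne t' t htt ⟨hx' ▸ (Y t').tl_mem x, (Y t).tl_mem _⟩) ((Y t).tl_ne p)
  · have htr : ∀ t p, tr ⟨t, some p⟩ = Sum.inr ⟨t, (Y t).tr p⟩ := fun _ _ => rfl
    have htr' : ∀ t, tr ⟨t, none⟩ = Sum.inl t.1 := fun _ => rfl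
    rintro ⟨t, _ | p⟩ ⟨t', _ | p'⟩ htt
    · obtain rfl := Subtype.ext (Sum.inl_injective htt)
      rfl
    · cases htt
    · cases htt
    · have h1 := Sum.inr_injective htt
      have h2 := congrArg Sigma.fst h1
      change t = t' at h2
      subst h2
      rw [(Y t).tr_inj (eq_of_heq (Sigma.mk.inj h1).2)]

/-- The system of a net without rules. -/
theorem System.nonempty_of_isEmpty [OrderTop AT] {κ : Type u} [IsEmpty κ]
    (ρ : κ → Rule.{u} AP AT) (d : κ → ℕ) {names : Set AT} (hN : ∀ t, N.tl t ∈ names) :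
    Nonempty (System ρ d names N) :=
  ⟨{ U := N
     base := 𝟙 N
     left := isEmptyElim
     right := isEmptyElim
     tr := isEmptyElim
     ownP := fun _ => none
     ownT := fun _ => none
     base_strict := isStrict_id N
     left_strict := isEmptyElim
     right_strict := isEmptyElim
     comm := isEmptyElim
     left_tr := isEmptyElim
     base_P := fun x => ⟨fun _ => rfl, fun _ => ⟨x, rfl⟩⟩
     base_T := fun x => ⟨fun _ => rfl, fun _ => ⟨x, rfl⟩⟩
     right_P := isEmptyElim
     right_T := isEmptyElim
     own_adj := fun _ _ _ _ _ h => h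
     depth_tr := isEmptyElim
     tl_mem := hN
     tl_ne := isEmptyElim
     tl_eq := isEmptyElim
     tr_inj := fun p => isEmptyElim p }⟩

end Construction
-- Flattening versus transformation units.
section Hierarchies

variable {AP : Type v} {AT : Type w} [PartialOrder AP] [PartialOrder AT]

namespace System

variable [OrderTop AT] {ι : Type u} {ρ : ι → Rule.{u} AP AT} {depth : ι → ℕ} {names : Set AT}
  {N : PTNet.{u} AP AT} (Y : System ρ depth names N)

/-- Passing to the owner of the replaced transition lowers the depth by exactly one, so depths have
no gaps. -/
theorem exists_depth_eq (Y : System ρ depth names N) {k : ℕ} (p : ι) (hp : k ≤ depth p) : ∃ q, depth q = k := by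
  induction hn : depth p generalizing p with
  | zero => exact ⟨p, by omega⟩
  | succ n ih =>
    obtain h | h := hp.eq_or_lt
    · exact ⟨p, h.symm⟩
    · obtain ⟨-, h0⟩ | ⟨q, -, hq⟩ := Y.depth_tr p
      · omega
      · exact ih q (by omega) (by omega)

theorem active_tr {k : ℕ} {p : ι} (hp : depth p ≤ k) :
    Active {q | depth q < k} (Y.ownT (Y.tr p)) := by
  obtain ⟨h, -⟩ | ⟨q, h, hq⟩ := Y.depth_tr p <;> rw [h]
  · exact active_none _
  · exact active_some.2 (show depth q < k by omega)

theorem closed_setOf_depth_lt (k : ℕ) : Y.Closed {p | depth p < k} :=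
  fun _ hp => Y.active_tr (le_of_lt hp)

end System

namespace SubstNet

variable {N : PTNet.{u} AP AT}

theorem rule_mk (lay : Layer N) (SN : lay.sT → PTNet.{u} AP AT)
    (emb : ∀ t : lay.sT, N.connOf t.1 ⟶ SN t) (emb_strict : ∀ t, IsStrict (emb t))
    (sub : ∀ t, SubstNet (SN t)) :
    rule (mk N lay SN emb emb_strict sub) =
      consRule (fun t => replaceRule N t.1 (emb t) (emb_strict t)) fun t => rule (sub t) := by
  rw [rule]
  funext q
  obtain ⟨t, _ | p⟩ := q <;> rfl

theorem depth_mk (lay : Layer N) (SN : lay.sT → PTNet.{u} AP AT)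
    (emb : ∀ t : lay.sT, N.connOf t.1 ⟶ SN t) (emb_strict : ∀ t, IsStrict (emb t))
    (sub : ∀ t, SubstNet (SN t)) :
    depth (mk N lay SN emb emb_strict sub) = consDepth fun t => depth (sub t) := by
  rw [depth]
  funext q
  obtain ⟨t, _ | p⟩ := q <;> rfl

theorem rule_isReplacement (h : SubstNet N) (p : Pos h) : (rule h p).IsReplacement := by
  induction h with
  | mk N lay SN emb emb_strict sub ih =>
    rw [rule_mk]
    obtain ⟨t, _ | p⟩ := p
    exacts [replaceRule_isReplacement _ _ _ _, ih t p]

theorem nameT_subset_allNamesT (h : SubstNet N) : h.layer.nameT ⊆ allNamesT h := by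
  cases h with
  | mk _ lay SN emb emb_strict sub =>
    rw [allNamesT]
    exact Set.subset_union_left

/-- Every substitution transition belongs to the net itself or to a subnet that is inserted by a
substitution rule of smaller depth. -/
theorem exists_isMatch (h : SubstNet N) (p : Pos h) :
    (∃ c : (rule h p).L ⟶ N, IsMatch c) ∨
      ∃ q, depth h q < depth h p ∧ ∃ c : (rule h p).L ⟶ (rule h q).R, IsMatch c := by
  induction h with
  | mk N lay SN emb emb_strict sub ih =>
    rw [rule_mk, depth_mk]
    obtain ⟨t, _ | p⟩ := p
    · exact Or.inl ⟨_, (N.netIncl_isStrict t.1).isMatch⟩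
    · obtain ⟨c, hc⟩ | ⟨q, hq, c, hc⟩ := ih t p
      · exact Or.inr ⟨⟨t, none⟩, Nat.succ_pos _, c, hc⟩
      · exact Or.inr ⟨⟨t, some q⟩, Nat.succ_lt_succ hq, c, hc⟩

variable [OrderTop AT]

theorem tl_left_mem (h : SubstNet N) (hw : WellNamed h) (p : Pos h) (t : (rule h p).L.T) :
    (rule h p).L.tl t ∈ allNamesT h ∧ (rule h p).L.tl t ≠ ⊤ := by
  induction h with
  | mk N lay SN emb emb_strict sub ih =>
    rw [WellNamed] at hw
    revert t
    rw [rule_mk, allNamesT]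
    obtain ⟨t, _ | p⟩ := p
    · exact fun _ => ⟨Or.inl (lay.net_over.2 t.1), hw.1 t.1 t.2⟩
    · exact fun x => ⟨Or.inr (Set.mem_iUnion.2 ⟨t, (ih t (hw.2.2.2.2 t) p x).1⟩),
        (ih t (hw.2.2.2.2 t) p x).2⟩

/-- Labels alone identify the rule, over the whole hierarchy. This is what protects a match from the
application of other rules. -/
theorem tl_left_injective (h : SubstNet N) (hw : WellNamed h) (p q : Pos h)
    (t : (rule h p).L.T) (t' : (rule h q).L.T)
    (htt : (rule h p).L.tl t = (rule h q).L.tl t') : p = q := by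
  induction h with
  | mk N lay SN emb emb_strict sub ih =>
    rw [WellNamed] at hw
    obtain ⟨htop, -, hN, hne, hsub⟩ := hw
    revert t t'
    rw [rule_mk]
    obtain ⟨s, _ | p⟩ := p <;> obtain ⟨s', _ | q⟩ := q <;> intro x x' hxx
    · have hss : N.tl s.1 = N.tl s'.1 := hxx
      obtain rfl := Subtype.ext (lay.tl_injOn s.2 s'.2 hss)
      rfl
    · have hxx' : N.tl s.1 = (rule (sub s') q).L.tl x' := hxx
      exact absurd (hN s' ⟨lay.net_over.2 s.1, hxx' ▸ (tl_left_mem _ (hsub s') q x').1⟩)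
        (htop s.1 s.2)
    · have hxx' : (rule (sub s) p).L.tl x = N.tl s'.1 := hxx
      exact absurd (hN s ⟨lay.net_over.2 s'.1, hxx' ▸ (tl_left_mem _ (hsub s) p x).1⟩)
        (htop s'.1 s'.2)
    · have hxx' : (rule (sub s) p).L.tl x = (rule (sub s') q).L.tl x' := hxx
      by_cases hss : s = s'
      · subst hss
        rw [ih s (hsub s) p q x x' hxx']
      · exact absurd (hne s s' hss ⟨(tl_left_mem _ (hsub s) p x).1,
          hxx' ▸ (tl_left_mem _ (hsub s') q x').1⟩) (tl_left_mem _ (hsub s) p x).2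

theorem nonempty_system (h : SubstNet N) (hw : WellNamed h) (hfin : Finite (Pos h)) :
    Nonempty (System (rule h) (depth h) (allNamesT h) N) := by
  induction h with
  | mk N lay SN emb emb_strict sub ih =>
    rw [WellNamed] at hw
    obtain ⟨htop, -, hN, hne, hsub⟩ := hw
    change Finite (Σ t : lay.sT, Option (Pos (sub t))) at hfin
    have : Finite lay.sT := Finite.of_injective
      (fun t => (⟨t, none⟩ : Σ t : lay.sT, Option (Pos (sub t)))) fun t t' htt =>
        congrArg Sigma.fst htt
    have hY : ∀ t, Nonempty (System (rule (sub t)) (depth (sub t)) (allNamesT (sub t)) (SN t)) :=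
      fun t => ih t (hsub t) (Finite.of_injective
        (fun p => (⟨t, some p⟩ : Σ t : lay.sT, Option (Pos (sub t)))) fun p p' hpp =>
          Option.some_injective _ (eq_of_heq (Sigma.mk.inj hpp).2))
    rw [rule_mk, depth_mk, allNamesT]
    exact System.nonempty_cons lay emb_strict (fun t => (hY t).some) htop hN hne

/-- Each parallel step turns the model of one level into that of the next and certifies rigidity of
the rules it applies. Rigidity is collected here because the sequential derivation cannot supply it.
-/
theorem FlattenFrom.exists_model (h : SubstNet N) [Finite (Pos h)] {names : Set AT}
    {Y : System (rule h) (depth h) names N} {k : ℕ} {M F : PTNet.{u} AP AT}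
    (H : FlattenFrom h k M F) {e : M ⟶ Y.U} (he : Y.Model {p | depth h p < k} e) :
    (∃ e' : F ⟶ Y.U, Y.Model Set.univ e') ∧ ∀ p, k ≤ depth h p → Y.Rigid p := by
  induction H with
  | done k M hk =>
    -- As depths have no gaps, an empty level means that nothing deeper is left.
    have hlt : ∀ p, depth h p < k := fun p => by
      by_contra hp
      obtain ⟨q, hq⟩ := Y.exists_depth_eq p (not_lt.1 hp)
      exact hk q hq
    have hu : {p | depth h p < k} = Set.univ := Set.eq_univ_of_forall hlt
    rw [hu] at he
    exact ⟨⟨e, he⟩, fun p hp => absurd (hlt p) (not_lt.2 hp)⟩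
  | next k M M' F hk step rest ih =>
    obtain ⟨⟨e', he'⟩, hrig, -⟩ := he.parallel (rule_isReplacement h) (Y.closed_setOf_depth_lt k)
      Subtype.val_injective (fun i : {p // depth h p = k} => Y.active_tr (le_of_eq i.2))
      (fun i hi => absurd i.2 (ne_of_lt hi)) step
    have hu : {p | depth h p < k} ∪ Set.range (Subtype.val : {p // depth h p = k} → Pos h) =
        {p | depth h p < k + 1} := by
      ext p
      simp [le_iff_lt_or_eq]
    rw [hu] at he'
    obtain ⟨h1, h2⟩ := ih he'
    refine ⟨h1, fun p hp => ?_⟩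
    obtain hp | hp := hp.eq_or_lt
    exacts [hrig ⟨p, hp.symm⟩, h2 p hp]

theorem finite_of_forall_mem_list {α : Type*} {l : List α} (hl : ∀ a, a ∈ l) :
    Finite α :=
  Set.finite_univ_iff.1 (l.finite_toSet.subset fun a _ => hl a)

theorem flatten_iso_transformationUnit (h : SubstNet N) (hw : WellNamed h)
    {F F' : PTNet.{u} AP AT} {l : List (Pos h)} (H : FlattenFrom h 0 N F)
    (H' : TransformationUnit (rule h) N l F') :
    Nonempty (F ≅ F') ∧ l.Nodup ∧ ∀ p, p ∈ l := by
  -- This argument does not involve the ambient net, and it provides the finiteness needed to build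
  -- one.
  have hl : ∀ p, p ∈ l := H'.mem_of_hierarchy (rule_isReplacement h) (tl_left_injective h hw)
    (depth h) (exists_isMatch h)
  have hfin := finite_of_forall_mem_list hl
  obtain ⟨Y⟩ := nonempty_system h hw hfin
  have h0 : {p | depth h p < 0} = ∅ := by simp
  obtain ⟨⟨e, he⟩, hrig⟩ := H.exists_model h (Y := Y) (h0 ▸ Y.model_base)
  obtain ⟨h1, -, e', he'⟩ := Y.model_base.derivation (rule_isReplacement h)
    (fun p hp => hp.elim) (fun p _ => hrig p (Nat.zero_le _)) H'.1
  have hu : ∅ ∪ {p | p ∈ l} = Set.univ := Set.eq_univ_of_forall fun p => Or.inr (hl p)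
  rw [hu] at he'
  exact ⟨he.nonempty_iso he', h1, hl⟩

end SubstNet

theorem Derivation.map {ι κ : Type u} {ρ : ι → Rule.{u} AP AT} (f : κ → ι)
    {N F : PTNet.{u} AP AT} {l : List κ} (H : Derivation (fun i => ρ (f i)) N l F) :
    Derivation ρ N (l.map f) F := by
  induction H with
  | nil N => exact .nil N
  | cons i o ho step rest ih => exact .cons (f i) o ho step ih

variable [OrderTop AT]

/-- The subnets are taken as systems without rules (index type `PEmpty`), so the ambient net has
height one and their own substitution transitions count as ordinary ones. -/
theorem SubstNet.parallel_iso_transformationUnit {N : PTNet.{u} AP AT} (h : SubstNet N)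
    (hw : h.WellNamed) {F F' : PTNet.{u} AP AT} {l : List h.layer.sT}
    (H : ParallelTransformation h.subst N F) (H' : TransformationUnit h.subst N l F') :
    Nonempty (F ≅ F') ∧ (l.Nodup ∧ ∀ t, t ∈ l) ∧
      ∀ t, ∃! s : Substitution h.subst N, s.idx = t := by
  cases h with
  | mk _ lay SN emb emb_strict sub =>
  rw [WellNamed] at hw
  obtain ⟨htop, -, hN, hne, -⟩ := hw
  change List lay.sT at l
  let top : lay.sT → Rule.{u} AP AT := fun t => replaceRule N t.1 (emb t) (emb_strict t)
  change ParallelTransformation top N F at H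
  change TransformationUnit top N l F' at H'
  change Nonempty (F ≅ F') ∧ (l.Nodup ∧ ∀ t, t ∈ l) ∧ ∀ t, ∃! s : Substitution top N, s.idx = t
  have htop_rep : ∀ t, (top t).IsReplacement := fun t => replaceRule_isReplacement _ _ _ _
  -- All transitions to be replaced lie in `N` already, so any depth function will do.
  have hl : ∀ t, t ∈ l := H'.mem_of_hierarchy htop_rep
    (fun t t' _ _ htt => Subtype.ext (lay.tl_injOn t.2 t'.2 htt)) (fun _ => 0)
    fun t => Or.inl ⟨_, (N.netIncl_isStrict t.1).isMatch⟩
  have := SubstNet.finite_of_forall_mem_list hl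
  let ρ' : ∀ _ : lay.sT, PEmpty.{u + 1} → Rule.{u} AP AT := fun _ => PEmpty.elim
  have hY : ∀ t, Nonempty (System (ρ' t) PEmpty.elim (sub t).layer.nameT (SN t)) :=
    fun t => System.nonempty_of_isEmpty _ _ (sub t).layer.net_over.2
  obtain ⟨Y⟩ := System.nonempty_cons lay emb_strict (fun t => (hY t).some) htop
    (fun t => (Set.inter_subset_inter_right _ (sub t).nameT_subset_allNamesT).trans (hN t))
    (fun t t' htt => (Set.inter_subset_inter (sub t).nameT_subset_allNamesT
      (sub t').nameT_subset_allNamesT).trans (hne t t' htt))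
  have hρ : ∀ p, (consRule top ρ' p).IsReplacement := by
    rintro ⟨t, _ | p⟩
    exacts [htop_rep t, p.elim]
  let f : lay.sT → Σ _ : lay.sT, Option PEmpty.{u + 1} := fun t => ⟨t, none⟩
  have hf : Function.Injective f := fun t t' htt => congrArg Sigma.fst htt
  have hc : Y.Closed ∅ := fun p hp => hp.elim
  obtain ⟨⟨e, he⟩, hrig, hex⟩ := Y.model_base.parallel hρ hc hf
    (fun t => by
      obtain ⟨h, -⟩ | ⟨q, -, hq⟩ := Y.depth_tr (f t)
      · rw [h]
        exact active_none _
      · cases hq)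
    (fun _ => id) H
  obtain ⟨h1, -, e', he'⟩ := Y.model_base.derivation hρ hc (l := l.map f)
    (fun p hp => by
      obtain ⟨t, -, rfl⟩ := List.mem_map.1 hp
      exact hrig t)
    (Derivation.map f H'.1)
  have hu : {p | p ∈ l.map f} = Set.range f := by
    ext p
    simp [hl]
  rw [hu] at he'
  exact ⟨he.nonempty_iso he', ⟨h1.of_map f, hl⟩, hex⟩

/-- An occurrence meets itself in the image of the replaced transition, whereas the interface has no
transitions. -/
theorem SubstNet.not_parallelIndependent_self {AP : Type v} {AT : Type w} [PartialOrder AP]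
    [PartialOrder AT] {N : PTNet.{u} AP AT} (h : SubstNet N) (s : Substitution h.subst N) :
    ¬ ParallelIndependent s s := by
  cases h with
  | mk _ lay SN emb emb_strict sub =>
  intro H
  have ht : Hom.fT s.occ PUnit.unit ∈ Set.range (Hom.fT s.occ) := ⟨_, rfl⟩
  obtain ⟨⟨x, -⟩, -⟩ := H.2 ⟨ht, ht⟩
  exact PEmpty.elim x

end Hierarchies

end PTNet

theorem mainTheorem6 {AP : Type v} {AT : Type w} [PartialOrder AP] [OrderTop AP]
    [PartialOrder AT] [OrderTop AT] (HN : PTNet.HierarchicalNet.{u} AP AT) :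
    -- substitution rules of the net itself: parallel transformation and transformation unit
    (∀ (F F' : PTNet.{u} AP AT) (l : List HN.toSubst.layer.sT),
      PTNet.ParallelTransformation HN.toSubst.subst HN.net F →
      PTNet.TransformationUnit HN.toSubst.subst HN.net l F' →
      Nonempty (F ≅ F') ∧ (l.Nodup ∧ ∀ t, t ∈ l) ∧
        ∀ t, ∃! s : PTNet.Substitution HN.toSubst.subst HN.net, s.idx = t) ∧
    -- substitution rules at all depths: recursive flattening and transformation unit
    (∀ (F F' : PTNet.{u} AP AT) (l : List HN.toSubst.Pos),
      HN.Flatten F →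
      PTNet.TransformationUnit HN.toSubst.rule HN.net l F' →
      Nonempty (F ≅ F') ∧ (l.Nodup ∧ ∀ p, p ∈ l)) ∧
    -- no substitution is independent of itself
    (∀ s : PTNet.Substitution HN.toSubst.subst HN.net, ¬ PTNet.ParallelIndependent s s) :=
  ⟨fun _ _ _ H H' => HN.toSubst.parallel_iso_transformationUnit HN.wellNamed H H',
    fun _ _ _ H H' => HN.toSubst.flatten_iso_transformationUnit HN.wellNamed H H',
    HN.toSubst.not_parallelIndependent_self⟩
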